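/- Let $\mathsf{SM}$ be the category of finite-dimensional real supermanifolds: an object is a Hausdorff, second countable topological space with a sheaf of supercommutative $\mathbb{R}$-superalgebras that is locally isomorphic to a superdomain $\mathbb{R}^{p|q}=(\mathbb{R}^p, C^\infty(\cdot)\otimes\Lambda(\mathbb{R}^q))$ (with $p,q$ fixed for the given supermanifold), and a morphism is a continuous map together with a parity-preserving morphism of sheaves of $\mathbb{R}$-superalgebras in the opposite direction. Regard $\mathbb{R}$ as the supermanifold $\mathbb{R}^{1|0}$, and for $\lambda\in\mathbb{R}$ let $g_\lambda:\mathbb{R}\to\mathbb{R}$, $g_\lambda(t)=\lambda t$. For supermanifolds $S$ and $M$, an $S$-curve on $M$ is an element of $$\underline{\mathrm{Hom}}(\mathbb{R},M)(S):=\mathrm{Hom}_{\mathsf{SM}}(S\times\mathbb{R},M),$$ where $S\times\mathbb{R}$ is the product in $\mathsf{SM}$. Define $$\widehat{h}_S:\mathbb{R}\times\underline{\mathrm{Hom}}(\mathbb{R},M)(S)\to\underline{\mathrm{Hom}}(\mathbb{R},M)(S),\qquad (\lambda,\gamma_S)\mapsto\gamma_S\circ(\mathrm{Id}_S\times g_\lambda),$$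 and for a morphism $\psi\in\mathrm{Hom}_{\mathsf{SM}}(P,S)$ define $$\Psi:\underline{\mathrm{Hom}}(\mathbb{R},M)(S)\to\underline{\mathrm{Hom}}(\mathbb{R},M)(P),\qquad \gamma_S\mapsto\gamma_S\circ(\psi\times\mathrm{Id}_{\mathbb{R}}).$$ **Proposition.** Let $M$ be a supermanifold. For every supermanifold $S$ the map $\widehat{h}_S$ is an action of the multiplicative semigroup $(\mathbb{R},\cdot)$ on the set of $S$-curves on $M$: $\widehat{h}_S(1,\gamma)=\gamma$ and $\widehat{h}_S(\lambda\mu,\gamma)=\widehat{h}_S(\lambda,\widehat{h}_S(\mu,\gamma))$ for all $\lambda,\mu\in\mathbb{R}$ and all $\gamma$. This action is natural in $S$: for all supermanifolds $P$, $S$ and every morphism $\psi\in\mathrm{Hom}_{\mathsf{SM}}(P,S)$, $$\widehat{h}_P\circ(\mathrm{Id}_{\mathbb{R}}\times\Psi)=\Psi\circ\widehat{h}_S .$$ -/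

import Mathlib

/-! Supermanifolds as superringed spaces, and their curves.

The definitions are `IsSupercommutative`, `Grassmann`, `SuperSpace`, `SuperSpace.Hom`, `superDomain`,
`Supermanifold`, its category structure, `realLine`, `scaling`, `SCurve`, `SCurve.induced` and
`SCurve.act`. All other material proves that a supermanifold `S` has a categorical product with the
real line, so that the notation `S ⨯ realLine` of category theory applies. -/

namespace SuperGeometry

open TopologicalSpace
open scoped ContDiff

section Analysis

variable {E Λ : Type} [NormedAddCommGroup E] [NormedSpace ℝ E]

theorem contDiff_integral_nat [FiniteDimensional ℝ E] (n : ℕ) :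
    ∀ {F : Type} [NormedAddCommGroup F] [NormedSpace ℝ F] [CompleteSpace F] (g : E × ℝ → F),
      ContDiff ℝ n g → ContDiff ℝ n (fun x => ∫ s in (0:ℝ)..1, g (x, s)) := by
  induction n with
  | zero =>
    intro F _ _ _ g hg
    rw [Nat.cast_zero, contDiff_zero] at *
    exact intervalIntegral.continuous_parametric_intervalIntegral_of_continuous'
      (f := fun x s => g (x, s)) (by simpa [Function.uncurry_def] using hg) 0 1
  | succ n ih =>
    intro F _ _ _ g hg
    have hg1 : ContDiff ℝ 1 g := hg.of_le (by norm_cast; omega)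
    set g' : E × ℝ → E →L[ℝ] F := fun p => (fderiv ℝ g p).comp (ContinuousLinearMap.inl ℝ E ℝ) with hg'
    have hcd : ContDiff ℝ n g' := by
      have h1 : ContDiff ℝ n (fderiv ℝ g) := hg.fderiv_right (by norm_cast)
      exact h1.clm_comp contDiff_const
    have hder : ∀ x s, HasFDerivAt (fun y => g (y, s)) (g' (x, s)) x := by
      intro x s
      have h1 : HasFDerivAt g (fderiv ℝ g (x, s)) (x, s) :=
        (hg1.differentiable one_ne_zero).differentiableAt.hasFDerivAt
      have h2 : HasFDerivAt (fun y : E => (y, s)) (ContinuousLinearMap.inl ℝ E ℝ) x :=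
        hasFDerivAt_prodMk_left x s
      exact h1.comp x h2
    have hcont' : Continuous g' := hcd.continuous
    have key : ∀ x, HasFDerivAt (fun x => ∫ s in (0:ℝ)..1, g (x, s)) (∫ s in (0:ℝ)..1, g' (x, s)) x := by
      intro x
      obtain ⟨C, hC⟩ := ((isCompact_closedBall x 1).prod (isCompact_Icc (a := (0:ℝ)) (b := 1))).exists_bound_of_continuousOn
        (f := g') hcont'.continuousOn
      refine (intervalIntegral.hasFDerivAt_integral_of_dominated_of_fderiv_le (μ := MeasureTheory.volume)
        (F := fun x s => g (x, s)) (F' := fun x s => g' (x, s)) (bound := fun _ => C)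
        (Metric.ball_mem_nhds x one_pos) ?_ ?_ ?_ ?_ ?_ ?_)
      · exact Filter.Eventually.of_forall fun y =>
          (hg1.continuous.comp (by fun_prop : Continuous fun s : ℝ => (y, s))).aestronglyMeasurable
      · exact (hg1.continuous.comp (by fun_prop : Continuous fun s : ℝ => (x, s))).intervalIntegrable _ _
      · exact (hcont'.comp (by fun_prop : Continuous fun s : ℝ => (x, s))).aestronglyMeasurable
      · refine Filter.Eventually.of_forall fun s hs y hy => ?_
        rw [Set.uIoc_of_le zero_le_one] at hs
        exact hC (y, s) ⟨Metric.ball_subset_closedBall hy, ⟨hs.1.le, hs.2⟩⟩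
      · exact intervalIntegrable_const
      · exact Filter.Eventually.of_forall fun s hs y hy => hder y s
    have := (contDiff_succ_iff_hasFDerivAt (𝕜 := ℝ) (n := n)
      (f := fun x => ∫ s in (0:ℝ)..1, g (x, s))).2 ⟨_, ih g' hcd, key⟩
    exact_mod_cast this

theorem contDiff_integral [FiniteDimensional ℝ E] {F : Type} [NormedAddCommGroup F] [NormedSpace ℝ F]
    [CompleteSpace F] (g : E × ℝ → F) (hg : ContDiff ℝ ∞ g) :
    ContDiff ℝ ∞ (fun x => ∫ s in (0:ℝ)..1, g (x, s)) :=
  contDiff_infty.2 fun n => contDiff_integral_nat n g (contDiff_infty.1 hg n)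

/-- Hadamard's lemma with parameters. -/
theorem hadamard {X F ι : Type} [NormedAddCommGroup X] [NormedSpace ℝ X] [FiniteDimensional ℝ X]
    [FiniteDimensional ℝ E] [Fintype ι] (b : Module.Basis ι ℝ E)
    [NormedAddCommGroup F] [NormedSpace ℝ F] [CompleteSpace F]
    (g : X × E → F) (hg : ContDiff ℝ ∞ g) (a : X → E) (ha : ContDiff ℝ ∞ a) :
    ∃ h : ι → X × E → F, (∀ i, ContDiff ℝ ∞ (h i)) ∧
      ∀ x y, g (x, y) = g (x, a x) + ∑ i, b.coord i (y - a x) • h i (x, y) := by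
  have hfd : ContDiff ℝ ∞ (fderiv ℝ g) := hg.fderiv_right (by simp)
  refine ⟨fun i p => ∫ s in (0:ℝ)..1, fderiv ℝ g (p.1, a p.1 + s • (p.2 - a p.1)) (0, b i), ?_, ?_⟩
  · intro i
    refine contDiff_integral (E := X × E)
      (fun p => fderiv ℝ g (p.1.1, a p.1.1 + p.2 • (p.1.2 - a p.1.1)) (0, b i)) ?_
    refine ContDiff.clm_apply (hfd.comp ?_) contDiff_const
    fun_prop
  · intro x y
    have hderiv : ∀ s : ℝ, HasDerivAt (fun s : ℝ => g (x, a x + s • (y - a x)))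
        (fderiv ℝ g (x, a x + s • (y - a x)) (0, y - a x)) s := by
      intro s
      have h1 : HasFDerivAt g (fderiv ℝ g (x, a x + s • (y - a x))) (x, a x + s • (y - a x)) :=
        (hg.differentiable (by simp)).differentiableAt.hasFDerivAt
      have h2 : HasDerivAt (fun s : ℝ => (x, a x + s • (y - a x))) ((0 : X), y - a x) s := by
        refine (hasDerivAt_const s x).prodMk ?_
        simpa using ((hasDerivAt_id s).smul_const (y - a x)).const_add (a x)
      exact h1.comp_hasDerivAt s h2
    have hc : ∀ w : E, Continuous fun s : ℝ => fderiv ℝ g (x, a x + s • (y - a x)) (0, w) := by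
      intro w
      have h0 := hfd.continuous
      fun_prop
    have hint := intervalIntegral.integral_eq_sub_of_hasDerivAt (a := 0) (b := 1)
      (fun s _ => hderiv s) ((hc _).intervalIntegrable _ _)
    have hsum : ∀ s : ℝ, fderiv ℝ g (x, a x + s • (y - a x)) (0, y - a x) =
        ∑ i, b.coord i (y - a x) • fderiv ℝ g (x, a x + s • (y - a x)) (0, b i) := by
      intro s
      have : ((0 : X), y - a x) = ∑ i, b.coord i (y - a x) • ((0 : X), b i) := by
        refine Prod.ext (by simp [Prod.fst_sum]) ?_
        simp only [Prod.snd_sum, Prod.smul_mk, Module.Basis.coord_apply]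
        exact (b.sum_repr _).symm
      conv_lhs => rw [this]
      simp only [map_sum, map_smul]
    simp only [hsum] at hint
    rw [intervalIntegral.integral_finsetSum (f := fun i s => b.coord i (y - a x) • fderiv ℝ g (x, a x + s • (y - a x)) (0, b i))
      (fun i _ => ((hc _).const_smul _).intervalIntegrable _ _)] at hint
    simp only [intervalIntegral.integral_smul] at hint
    rw [hint]
    simp

/-- finite Taylor expansion in one variable with smooth parameters -/
theorem hadamard_taylor [FiniteDimensional ℝ E] {F : Type}
    [NormedAddCommGroup F] [NormedSpace ℝ F] [CompleteSpace F] (t₀ : ℝ) (N : ℕ) :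
    ∀ (g : E × ℝ → F), ContDiff ℝ ∞ g →
    ∃ (c : ℕ → E → F) (r : E × ℝ → F), (∀ k, ContDiff ℝ ∞ (c k)) ∧ ContDiff ℝ ∞ r ∧
      ∀ x t, g (x, t) = ∑ k ∈ Finset.range N, (t - t₀) ^ k • c k x + (t - t₀) ^ N • r (x, t) := by
  induction N with
  | zero => exact fun g hg => ⟨fun _ _ => 0, g, fun _ => contDiff_const, hg, by simp⟩
  | succ N ih =>
    intro g hg
    obtain ⟨h, hh, he⟩ := hadamard (Module.Basis.singleton Unit ℝ) g hg (fun _ => t₀) contDiff_const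
    obtain ⟨c, r, hc, hr, hcr⟩ := ih (h ()) (hh ())
    refine ⟨fun k => Nat.casesOn k (fun x => g (x, t₀)) c, r, ?_, hr, ?_⟩
    · rintro (_ | k)
      · exact hg.comp (contDiff_id.prodMk contDiff_const)
      · exact hc k
    · intro x t
      rw [he, Finset.sum_range_succ']
      simp only [Finset.univ_unique, Finset.sum_singleton, Module.Basis.coord_apply,
        Module.Basis.singleton_repr]
      rw [show (default : Unit) = () from rfl, hcr, smul_add, Finset.smul_sum]
      simp only [smul_smul, pow_succ', pow_zero, one_smul]
      rw [add_comm, add_right_comm]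
      rfl

variable [NormedRing Λ] [NormedAlgebra ℝ Λ]

/-- The truncated Taylor expansion, evaluated at the point `t + ν` with `ν` nilpotent. -/
noncomputable def jetEval (N : ℕ) (γ : ℝ → Λ) (t : ℝ) (ν : Λ) : Λ :=
  ∑ k ∈ Finset.range N, ((k.factorial : ℝ)⁻¹ • iteratedDeriv k γ t) * ν ^ k

theorem jetEval_congr {N : ℕ} {γ δ : ℝ → Λ} {t : ℝ} {ν : Λ} (h : γ =ᶠ[nhds t] δ) :
    jetEval N γ t ν = jetEval N δ t ν := by
  unfold jetEval
  refine Finset.sum_congr rfl fun k _ => ?_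
  rw [h.iteratedDeriv_eq k]

theorem jetEval_add {N : ℕ} {γ δ : ℝ → Λ} {t : ℝ} {ν : Λ} (hγ : ContDiffAt ℝ ∞ γ t)
    (hδ : ContDiffAt ℝ ∞ δ t) :
    jetEval N (γ + δ) t ν = jetEval N γ t ν + jetEval N δ t ν := by
  unfold jetEval
  rw [← Finset.sum_add_distrib]
  refine Finset.sum_congr rfl fun k _ => ?_
  rw [iteratedDeriv_add (hγ.of_le (by exact_mod_cast le_top)) (hδ.of_le (by exact_mod_cast le_top)),
    smul_add, add_mul]

theorem jetEval_const {N : ℕ} (hN : N ≠ 0) (a : Λ) (t : ℝ) (ν : Λ) :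
    jetEval N (fun _ => a) t ν = a := by
  obtain ⟨M, rfl⟩ := Nat.exists_eq_succ_of_ne_zero hN
  unfold jetEval
  rw [Finset.sum_range_succ']
  simp [iteratedDeriv_const]

theorem jetEval_mul {N : ℕ} {γ δ : ℝ → Λ} {t : ℝ} {ν : Λ} (hγ : ContDiffAt ℝ ∞ γ t)
    (hδ : ContDiffAt ℝ ∞ δ t) (hν : ∀ a, Commute ν a) (hN : ν ^ N = 0) :
    jetEval N (γ * δ) t ν = jetEval N γ t ν * jetEval N δ t ν := by
  unfold jetEval
  have e1 : ∀ k, ((k.factorial : ℝ)⁻¹ • iteratedDeriv k (γ * δ) t) * ν ^ k =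
      ∑ p ∈ Finset.HasAntidiagonal.antidiagonal k, (((p.1.factorial : ℝ)⁻¹ • iteratedDeriv p.1 γ t) * ν ^ p.1) *
        (((p.2.factorial : ℝ)⁻¹ • iteratedDeriv p.2 δ t) * ν ^ p.2) := by
    intro k
    rw [iteratedDeriv_mul (hγ.of_le (by exact_mod_cast le_top)) (hδ.of_le (by exact_mod_cast le_top)),
      Finset.Nat.sum_antidiagonal_eq_sum_range_succ_mk, Finset.smul_sum, Finset.sum_mul]
    refine Finset.sum_congr rfl fun i hi => ?_
    have hik : i ≤ k := Nat.lt_succ_iff.1 (Finset.mem_range.1 hi)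
    set A := iteratedDeriv i γ t
    set B := iteratedDeriv (k - i) δ t
    have hc : (ν ^ i) * B = B * ν ^ i := ((hν B).pow_left i)
    have e2 : ν ^ k = ν ^ i * ν ^ (k - i) := by rw [← pow_add]; congr 1; omega
    have e3 : ((k.choose i : ℕ) : Λ) = algebraMap ℝ Λ (k.choose i : ℝ) := by simp
    rw [e2, e3]
    simp only [← Algebra.smul_def, smul_mul_assoc, mul_smul_comm, smul_smul]
    have e4 : A * B * (ν ^ i * ν ^ (k - i)) = A * ν ^ i * (B * ν ^ (k - i)) := by
      rw [mul_assoc A, ← mul_assoc B, ← hc]; simp only [mul_assoc]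
    rw [e4]
    congr 1
    rw [Nat.cast_choose ℝ hik]
    have := Nat.factorial_ne_zero k
    field_simp
  simp only [e1]
  rw [Finset.sum_mul_sum, ← Finset.sum_product']
  rw [Finset.sum_sigma']
  have hz : ∀ p : ℕ × ℕ, N ≤ p.1 + p.2 → (((p.1.factorial : ℝ)⁻¹ • iteratedDeriv p.1 γ t) * ν ^ p.1) *
        (((p.2.factorial : ℝ)⁻¹ • iteratedDeriv p.2 δ t) * ν ^ p.2) = 0 := by
    intro p hp
    set A := (p.1.factorial : ℝ)⁻¹ • iteratedDeriv p.1 γ t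
    set B := (p.2.factorial : ℝ)⁻¹ • iteratedDeriv p.2 δ t
    have hc : (ν ^ p.1) * B = B * ν ^ p.1 := ((hν B).pow_left _)
    have h0 : ν ^ p.1 * ν ^ p.2 = 0 := by rw [← pow_add]; exact pow_eq_zero_of_le hp hN
    calc A * ν ^ p.1 * (B * ν ^ p.2) = A * (ν ^ p.1 * B) * ν ^ p.2 := by simp only [mul_assoc]
      _ = A * B * (ν ^ p.1 * ν ^ p.2) := by rw [hc]; simp only [mul_assoc]
      _ = 0 := by rw [h0, mul_zero]
  rw [← Finset.sum_filter_of_ne (s := Finset.range N ×ˢ Finset.range N) (p := fun p => p.1 + p.2 < N)]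
  · refine Finset.sum_bij' (fun p _ => p.2) (fun p _ => ⟨p.1 + p.2, p⟩) ?_ ?_ ?_ ?_ ?_
    · rintro ⟨k, p⟩ hp
      simp only [Finset.mem_sigma, Finset.mem_range, Finset.HasAntidiagonal.mem_antidiagonal, Finset.mem_filter,
        Finset.mem_product] at *
      omega
    · rintro p hp
      simp only [Finset.mem_filter] at hp
      refine Finset.mem_sigma.2 ⟨Finset.mem_range.2 hp.2, Finset.HasAntidiagonal.mem_antidiagonal.2 rfl⟩
    · rintro ⟨k, p⟩ hp
      simp only [Finset.mem_sigma, Finset.mem_range, Finset.HasAntidiagonal.mem_antidiagonal] at hp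
      obtain ⟨_, rfl⟩ := hp
      rfl
    · rintro p hp; rfl
    · rintro ⟨k, p⟩ hp; rfl
  · intro p _ hne
    by_contra hlt
    exact hne (hz p (not_lt.1 hlt))

theorem jetEval_id {N : ℕ} (hN : 2 ≤ N) (t : ℝ) (ν : Λ) :
    jetEval N (fun s => algebraMap ℝ Λ s) t ν = algebraMap ℝ Λ t + ν := by
  obtain ⟨M, rfl⟩ := Nat.exists_eq_add_of_le' hN
  unfold jetEval
  have h1 : deriv (fun s => algebraMap ℝ Λ s) = fun _ => (1 : Λ) := by
    funext s
    have := (hasDerivAt_id s).smul_const (1 : Λ)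
    simp only [one_smul] at this
    simpa [Algebra.algebraMap_eq_smul_one] using this.deriv
  rw [Finset.sum_range_succ', Finset.sum_range_succ']
  have h2 : ∀ k, iteratedDeriv (k + 1 + 1) (fun s => algebraMap ℝ Λ s) t = 0 := by
    intro k
    rw [iteratedDeriv_succ', h1, iteratedDeriv_const]; simp
  simp only [h2]
  simp [iteratedDeriv_succ', h1, add_comm]

/-- differentiation in the second variable -/
noncomputable def dt (G : E × ℝ → Λ) : E × ℝ → Λ := fun p => fderiv ℝ G p (0, 1)

theorem dt_contDiffOn {G : E × ℝ → Λ} {W : Set (E × ℝ)} (hW : IsOpen W) (hG : ContDiffOn ℝ ∞ G W) :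
    ContDiffOn ℝ ∞ (dt G) W :=
  (hG.fderiv_of_isOpen hW (by simp)).clm_apply contDiffOn_const

theorem dt_iterate_contDiffOn {G : E × ℝ → Λ} {W : Set (E × ℝ)} (hW : IsOpen W)
    (hG : ContDiffOn ℝ ∞ G W) (k : ℕ) : ContDiffOn ℝ ∞ (dt^[k] G) W := by
  induction k with
  | zero => exact hG
  | succ k ih => rw [Function.iterate_succ_apply']; exact dt_contDiffOn hW ih

theorem iteratedDeriv_slice {G : E × ℝ → Λ} {W : Set (E × ℝ)} (hW : IsOpen W)
    (hG : ContDiffOn ℝ ∞ G W) (k : ℕ) : ∀ v t, (v, t) ∈ W →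
      iteratedDeriv k (fun s => G (v, s)) t = (dt^[k] G) (v, t) := by
  induction k with
  | zero => intro v t _; simp
  | succ k ih =>
    intro v t hvt
    rw [iteratedDeriv_succ, Function.iterate_succ_apply']
    have hev : iteratedDeriv k (fun s => G (v, s)) =ᶠ[nhds t] fun s => (dt^[k] G) (v, s) := by
      have : ∀ᶠ s in nhds t, (v, s) ∈ W :=
        (by fun_prop : Continuous fun s : ℝ => (v, s)).continuousAt.preimage_mem_nhds (hW.mem_nhds hvt)
      filter_upwards [this] with s hs using ih v s hs
    rw [hev.deriv_eq]
    have hd : HasFDerivAt (dt^[k] G) (fderiv ℝ (dt^[k] G) (v, t)) (v, t) :=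
      (((dt_iterate_contDiffOn hW hG k).contDiffAt (hW.mem_nhds hvt)).differentiableAt
        (by simp)).hasFDerivAt
    have h2 : HasDerivAt (fun s : ℝ => (v, s)) ((0 : E), (1 : ℝ)) t :=
      (hasDerivAt_const t v).prodMk (hasDerivAt_id t)
    exact (hd.comp_hasDerivAt t h2).deriv

theorem jetEval_contDiffOn {G : E × ℝ → Λ} {W : Set (E × ℝ)} (hW : IsOpen W)
    (hG : ContDiffOn ℝ ∞ G W) (N : ℕ) {U : Set E} {t : E → ℝ} {ν : E → Λ} (ht : ContDiffOn ℝ ∞ t U)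
    (hν : ContDiffOn ℝ ∞ ν U) (hU : ∀ v ∈ U, (v, t v) ∈ W) :
    ContDiffOn ℝ ∞ (fun v => jetEval N (fun s => G (v, s)) (t v) (ν v)) U := by
  unfold jetEval
  refine ContDiffOn.sum fun k _ => ContDiffOn.mul ?_ (hν.pow k)
  refine ContDiffOn.const_smul _ ?_
  have : ContDiffOn ℝ ∞ (fun v => (dt^[k] G) (v, t v)) U :=
    (dt_iterate_contDiffOn hW hG k).comp (contDiffOn_id.prodMk ht) hU
  refine this.congr fun v hv => iteratedDeriv_slice hW hG k v _ (hU v hv)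

/-- An algebra homomorphism depending smoothly on a parameter acts smoothly on smooth families. -/
theorem smooth_family {E' Λ' : Type} [NormedAddCommGroup E'] [NormedSpace ℝ E']
    [FiniteDimensional ℝ E] [FiniteDimensional ℝ Λ]
    [NormedRing Λ'] [NormedAlgebra ℝ Λ']
    (A : Subalgebra ℝ (E → Λ)) (hA : ∀ f, f ∈ A ↔ ContDiff ℝ ∞ f)
    (I : Submodule ℝ Λ') {N : ℕ} (hI : I ^ N = ⊥)
    {B : Set E'} (K : E' → A →ₐ[ℝ] Λ') (hK : ∀ f, ContDiffOn ℝ ∞ (fun v => K v f) B)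
    (β : E' → E) (hβ : ContDiffOn ℝ ∞ β B)
    (hKβ : ∀ v ∈ B, ∀ ℓ : E →ₗ[ℝ] ℝ, ∀ f : A, (f : E → Λ) = (fun y => algebraMap ℝ Λ (ℓ (y - β v))) →
      K v f ∈ I)
    (G : E × ℝ → Λ) (hG : ContDiff ℝ ∞ G) :
    ∃ S : E' × ℝ → Λ', ContDiffOn ℝ ∞ S (B ×ˢ Set.univ) ∧ ∀ v ∈ B, ∀ t, ∀ f : A,
      (f : E → Λ) = (fun y => G (y, t)) → K v f = S (v, t) := by
  have main : ∀ k : ℕ, ∀ g : (ℝ × E) × E → Λ, ContDiff ℝ ∞ g →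
      ∃ S : E' × ℝ → Λ', ContDiffOn ℝ ∞ S (B ×ˢ Set.univ) ∧ ∀ v ∈ B, ∀ t, ∀ f : A,
      (f : E → Λ) = (fun y => g ((t, β v), y)) → K v f - S (v, t) ∈ I ^ k * ⊤ := by
    intro k
    induction k with
    | zero =>
      intro g hg
      exact ⟨fun _ => 0, contDiffOn_const, fun v hv t f hf => by rw [pow_zero, one_mul]; trivial⟩
    | succ k ih =>
      intro g hg
      let b := Module.finBasis ℝ E
      let e := Module.finBasis ℝ Λ
      obtain ⟨h, hh, he⟩ := hadamard b g hg Prod.snd contDiff_snd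
      choose S hS hS' using fun i => ih (h i) (hh i)
      let co : ∀ i, A := fun i => ⟨fun y => algebraMap ℝ Λ (b.coord i y), (hA _).2 <| by
        simp only [Algebra.algebraMap_eq_smul_one]
        exact ((LinearMap.toContinuousLinearMap (b.coord i)).contDiff).smul contDiff_const⟩
      let ν : Fin (Module.finrank ℝ E) → E' → Λ' := fun i v =>
        K v (co i) - algebraMap ℝ Λ' (b.coord i (β v))
      have hcoβ : ∀ i, ContDiffOn ℝ ∞ (fun v => b.coord i (β v)) B := fun i =>
        (LinearMap.toContinuousLinearMap (b.coord i)).contDiff.comp_contDiffOn hβ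
      have hν : ∀ i, ContDiffOn ℝ ∞ (ν i) B := by
        intro i
        refine (hK (co i)).sub ?_
        simp only [Algebra.algebraMap_eq_smul_one]
        exact (hcoβ i).smul contDiffOn_const
      have hνI : ∀ i, ∀ v ∈ B, ν i v ∈ I := by
        intro i v hv
        have : ν i v = K v (co i - algebraMap ℝ A (b.coord i (β v))) := by
          rw [map_sub, AlgHom.commutes]
        rw [this]
        refine hKβ v hv (b.coord i) _ ?_
        funext y
        change algebraMap ℝ Λ (b.coord i y) - algebraMap ℝ Λ (b.coord i (β v)) = _
        rw [← map_sub, ← map_sub]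
      let ce : ∀ j, A := fun j => ⟨fun _ => e j, (hA _).2 contDiff_const⟩
      have hfst : ∀ {F : E' → Λ'}, ContDiffOn ℝ ∞ F B →
          ContDiffOn ℝ ∞ (fun p : E' × ℝ => F p.1) (B ×ˢ Set.univ) := fun hF =>
        hF.comp contDiffOn_fst (fun p hp => hp.1)
      have hβ' : ContDiffOn ℝ ∞ (fun p : E' × ℝ => β p.1) (B ×ˢ Set.univ) :=
        hβ.comp contDiffOn_fst (fun p hp => hp.1)
      refine ⟨fun p => ∑ j, e.coord j (g ((p.2, β p.1), β p.1)) • K p.1 (ce j) +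
        ∑ i, ν i p.1 * S i p, ?_, ?_⟩
      · refine ContDiffOn.add (ContDiffOn.sum fun j _ =>
          ContDiffOn.fun_smul ?_ (hfst (hK (ce j))))
          (ContDiffOn.sum fun i _ => (hfst (hν i)).mul (hS i))
        refine (LinearMap.toContinuousLinearMap (e.coord j)).contDiff.comp_contDiffOn
          (hg.comp_contDiffOn ?_)
        exact (contDiffOn_snd.prodMk hβ').prodMk hβ'
      · intro v hv t f hf
        let hA' : ∀ i, A := fun i => ⟨fun y => h i ((t, β v), y), (hA _).2 <|
          (hh i).comp (contDiff_const.prodMk contDiff_id)⟩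
        have hfe : f = ∑ j, e.coord j (g ((t, β v), β v)) • ce j +
            ∑ i, (co i - algebraMap ℝ A (b.coord i (β v))) * hA' i := by
          apply Subtype.ext
          rw [hf]
          funext y
          rw [he]
          simp only [AddMemClass.coe_add, AddSubmonoidClass.coe_finsetSum, Pi.add_apply,
            Finset.sum_apply]
          congr 1
          · exact (e.sum_repr (g ((t, β v), β v))).symm
          · refine Finset.sum_congr rfl fun i _ => ?_
            change _ = (algebraMap ℝ Λ (b.coord i y) - algebraMap ℝ Λ (b.coord i (β v))) * _
            rw [← map_sub, ← map_sub, Algebra.smul_def]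
        have hKf : K v f = ∑ j, e.coord j (g ((t, β v), β v)) • K v (ce j) +
            ∑ i, ν i v * K v (hA' i) := by
          conv_lhs => rw [hfe]
          simp only [map_add, map_sum, map_smul, map_mul, map_sub, AlgHom.commutes, ν]
        rw [hKf, add_sub_add_left_eq_sub, ← Finset.sum_sub_distrib]
        refine Submodule.sum_mem _ fun i _ => ?_
        rw [← mul_sub, pow_succ', mul_assoc]
        exact Submodule.mul_mem_mul (hνI i v hv) (hS' i v hv t (hA' i) rfl)
  obtain ⟨S, hS, hS'⟩ := main N (fun p => G (p.2, p.1.1)) (by fun_prop)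
  refine ⟨S, hS, fun v hv t f hf => ?_⟩
  have := hS' v hv t f hf
  rw [hI, Submodule.bot_mul, Submodule.mem_bot, sub_eq_zero] at this
  exact this

end Analysis

/-! ### Supercommutative algebras and Grassmann algebras -/

/-- `par 0` (even part) and `par 1` (odd part) make `A` a supercommutative `ℝ`-superalgebra. -/
structure IsSupercommutative {A : Type} [Ring A] [Algebra ℝ A] (par : ZMod 2 → Submodule ℝ A) :
    Prop where
  isCompl : IsCompl (par 0) (par 1)
  one_mem : 1 ∈ par 0
  mul_mem : ∀ {i j : ZMod 2} {a b : A}, a ∈ par i → b ∈ par j → a * b ∈ par (i + j)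
  even_comm : ∀ {a : A}, a ∈ par 0 → ∀ b : A, a * b = b * a
  odd_anticomm : ∀ {a b : A}, a ∈ par 1 → b ∈ par 1 → a * b = -(b * a)

/-- The real Grassmann algebra on `q` odd generators. -/
abbrev Grassmann (q : ℕ) : Type := ExteriorAlgebra ℝ (Fin q → ℝ)

/-- The even and the odd part of the Grassmann algebra. -/
abbrev Grassmann.par (q : ℕ) (i : ZMod 2) : Submodule ℝ (Grassmann q) :=
  CliffordAlgebra.evenOdd (0 : QuadraticForm ℝ (Fin q → ℝ)) i

theorem Grassmann.isSupercommutative (q : ℕ) : IsSupercommutative (Grassmann.par q) where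
  isCompl := CliffordAlgebra.evenOdd_isCompl _
  one_mem := SetLike.GradedOne.one_mem
  mul_mem := fun ha hb => SetLike.GradedMul.mul_mem ha hb
  even_comm := by
    intro a ha b
    refine CliffordAlgebra.even_induction _ (motive := fun a _ => a * b = b * a) ?_ ?_ ?_ a ha
    · intro r; exact Algebra.commutes r b
    · intro x y hx hy h1 h2; rw [add_mul, mul_add, h1, h2]
    · intro m₁ m₂ x hx h
      have hmm : ∀ m : Fin q → ℝ, ∀ b : Grassmann q, ExteriorAlgebra.ι ℝ m₁ * ExteriorAlgebra.ι ℝ m₂ * b =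
          b * (ExteriorAlgebra.ι ℝ m₁ * ExteriorAlgebra.ι ℝ m₂) := by
        intro _ b
        induction b using ExteriorAlgebra.induction with
        | algebraMap r => exact (Algebra.commutes r _).symm
        | ι m =>
          have e1 := eq_neg_of_add_eq_zero_left (ExteriorAlgebra.ι_add_mul_swap (R := ℝ) m₂ m)
          have e2 := eq_neg_of_add_eq_zero_left (ExteriorAlgebra.ι_add_mul_swap (R := ℝ) m₁ m)
          rw [mul_assoc, e1, mul_neg, ← mul_assoc, e2, neg_mul, neg_neg, mul_assoc]
        | mul a b ha hb => rw [← mul_assoc, ha, mul_assoc, hb, mul_assoc]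
        | add a b ha hb => rw [mul_add, add_mul, ha, hb]
      have := hmm 0 b
      change ExteriorAlgebra.ι ℝ m₁ * ExteriorAlgebra.ι ℝ m₂ * x * b =
        b * (ExteriorAlgebra.ι ℝ m₁ * ExteriorAlgebra.ι ℝ m₂ * x)
      rw [mul_assoc, h, ← mul_assoc, this, mul_assoc]
  odd_anticomm := by
    intro a b ha hb
    have hι : ∀ m : Fin q → ℝ, ∀ b ∈ Grassmann.par q 1, ExteriorAlgebra.ι ℝ m * b =
        -(b * ExteriorAlgebra.ι ℝ m) := by
      intro m b hb
      refine CliffordAlgebra.odd_induction (Q := (0 : QuadraticForm ℝ (Fin q → ℝ)))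
        (P := fun b _ => ExteriorAlgebra.ι ℝ m * b = -(b * ExteriorAlgebra.ι ℝ m)) ?_ ?_ ?_ b hb
      · intro v; exact eq_neg_of_add_eq_zero_left (ExteriorAlgebra.ι_add_mul_swap (R := ℝ) m v)
      · intro x y hx hy h1 h2; rw [add_mul, mul_add, h1, h2, neg_add]
      · intro m₁ m₂ x hx h
        have e1 := eq_neg_of_add_eq_zero_left (ExteriorAlgebra.ι_add_mul_swap (R := ℝ) m m₁)
        have e2 := eq_neg_of_add_eq_zero_left (ExteriorAlgebra.ι_add_mul_swap (R := ℝ) m m₂)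
        change ExteriorAlgebra.ι ℝ m * (ExteriorAlgebra.ι ℝ m₁ * ExteriorAlgebra.ι ℝ m₂ * x) =
          -(ExteriorAlgebra.ι ℝ m₁ * ExteriorAlgebra.ι ℝ m₂ * x * ExteriorAlgebra.ι ℝ m)
        calc ExteriorAlgebra.ι ℝ m * (ExteriorAlgebra.ι ℝ m₁ * ExteriorAlgebra.ι ℝ m₂ * x)
            = (ExteriorAlgebra.ι ℝ m * ExteriorAlgebra.ι ℝ m₁) * ExteriorAlgebra.ι ℝ m₂ * x := by
              simp only [mul_assoc]
          _ = -(ExteriorAlgebra.ι ℝ m₁ * (ExteriorAlgebra.ι ℝ m * ExteriorAlgebra.ι ℝ m₂) * x) := by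
              rw [e1]; simp only [neg_mul, mul_assoc]
          _ = ExteriorAlgebra.ι ℝ m₁ * ExteriorAlgebra.ι ℝ m₂ * (ExteriorAlgebra.ι ℝ m * x) := by
              rw [e2]; simp only [neg_mul, mul_neg, neg_neg, mul_assoc]
          _ = _ := by rw [h]; simp only [mul_neg, mul_assoc]
    refine CliffordAlgebra.odd_induction (Q := (0 : QuadraticForm ℝ (Fin q → ℝ)))
        (P := fun a _ => a * b = -(b * a)) ?_ ?_ ?_ a ha
    · intro v; exact hι v b hb
    · intro x y hx hy h1 h2; rw [add_mul, mul_add, h1, h2, neg_add]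
    · intro m₁ m₂ x hx h
      change ExteriorAlgebra.ι ℝ m₁ * ExteriorAlgebra.ι ℝ m₂ * x * b =
        -(b * (ExteriorAlgebra.ι ℝ m₁ * ExteriorAlgebra.ι ℝ m₂ * x))
      have e : ExteriorAlgebra.ι ℝ m₁ * ExteriorAlgebra.ι ℝ m₂ * b =
          b * (ExteriorAlgebra.ι ℝ m₁ * ExteriorAlgebra.ι ℝ m₂) := by
        rw [mul_assoc, hι m₂ b hb, mul_neg, ← mul_assoc, hι m₁ b hb, neg_mul, neg_neg, mul_assoc]
      rw [mul_assoc, h, mul_neg, ← mul_assoc, e, mul_assoc]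

/-- The body map, sending all odd generators to zero. -/
noncomputable abbrev Grassmann.body (q : ℕ) : Grassmann q →ₐ[ℝ] ℝ := ExteriorAlgebra.algebraMapInv

theorem Grassmann.body_pow (q : ℕ) :
    (LinearMap.ker (Grassmann.body q).toLinearMap) ^ (q + 1) = ⊥ := by
  set I := LinearMap.ker (Grassmann.body q).toLinearMap with hI
  set V : Submodule ℝ (Grassmann q) := LinearMap.range (ExteriorAlgebra.ι ℝ) with hV
  have hVtop : (⊤ : Submodule ℝ (Grassmann q)) * V ≤ V * ⊤ := by
    have key : ∀ m : Grassmann q, ∀ x ∈ V * ⊤, m * x ∈ V * ⊤ := by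
      intro m
      induction m using ExteriorAlgebra.induction with
      | algebraMap r => intro x hx; rw [← Algebra.smul_def]; exact Submodule.smul_mem _ _ hx
      | ι m => exact fun x _ => Submodule.mul_mem_mul ⟨m, rfl⟩ trivial
      | mul a b ha hb => intro x hx; rw [mul_assoc]; exact ha _ (hb _ hx)
      | add a b ha hb => intro x hx; rw [add_mul]; exact add_mem (ha _ hx) (hb _ hx)
    rw [Submodule.mul_le]
    intro m _ n hn
    refine key m n ?_
    rw [← mul_one n]
    exact Submodule.mul_mem_mul hn trivial
  have hIV : I ≤ V * ⊤ := by
    have : ∀ x : Grassmann q, x - algebraMap ℝ _ (Grassmann.body q x) ∈ V * ⊤ := by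
      intro x
      induction x using ExteriorAlgebra.induction with
      | algebraMap r => simp
      | ι m =>
        have : ExteriorAlgebra.ι ℝ m = ExteriorAlgebra.ι ℝ m * 1 := (mul_one _).symm
        simp only [ExteriorAlgebra.algebraMapInv, ExteriorAlgebra.lift_ι_apply]
        rw [LinearMap.zero_apply, map_zero, sub_zero, this]
        exact Submodule.mul_mem_mul ⟨m, rfl⟩ trivial
      | mul a b ha hb =>
        have e : a * b - algebraMap ℝ _ (Grassmann.body q (a * b)) =
          (a - algebraMap ℝ _ (Grassmann.body q a)) * b +
            Grassmann.body q a • (b - algebraMap ℝ _ (Grassmann.body q b)) := by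
          rw [map_mul, map_mul, sub_mul, smul_sub, Algebra.smul_def, Algebra.smul_def]; abel
        rw [e]
        refine add_mem ?_ (Submodule.smul_mem _ _ hb)
        have := Submodule.mul_mem_mul ha (show b ∈ (⊤ : Submodule ℝ (Grassmann q)) from trivial)
        rw [mul_assoc] at this
        exact (mul_le_mul' le_rfl le_top : V * (⊤ * ⊤) ≤ V * ⊤) this
      | add a b ha hb =>
        rw [map_add, map_add, add_sub_add_comm]; exact add_mem ha hb
    intro x hx
    have hx' : Grassmann.body q x = 0 := hx
    have := this x
    rwa [hx', map_zero, sub_zero] at this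
  have hpow : ∀ k, I ^ k ≤ V ^ k * ⊤ := by
    intro k
    induction k with
    | zero => rw [pow_zero, pow_zero, one_mul]; exact le_top
    | succ k ih =>
      calc I ^ (k + 1) = I ^ k * I := pow_succ _ _
        _ ≤ (V ^ k * ⊤) * (V * ⊤) := mul_le_mul' ih hIV
        _ = V ^ k * (⊤ * V) * ⊤ := by simp only [mul_assoc]
        _ ≤ V ^ k * (V * ⊤) * ⊤ := mul_le_mul' (mul_le_mul' le_rfl hVtop) le_rfl
        _ = V ^ (k + 1) * (⊤ * ⊤) := by rw [pow_succ]; simp only [mul_assoc]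
        _ ≤ V ^ (k + 1) * ⊤ := mul_le_mul' le_rfl le_top
  have hz : V ^ (q + 1) = ⊥ := by
    have h1 : Module.finrank ℝ (⋀[ℝ]^(q + 1) (Fin q → ℝ)) = 0 := by
      rw [exteriorPower.finrank_eq]; simp
    exact Submodule.finrank_eq_zero.1 h1
  have := hpow (q + 1)
  rw [hz, Submodule.bot_mul] at this
  exact le_bot_iff.1 this

instance Grassmann.finite (q : ℕ) : Module.Finite ℝ (Grassmann q) :=
  Module.Finite.of_basis (Pi.basisFun ℝ (Fin q)).ExteriorAlgebra

theorem Grassmann.nilpotent {q : ℕ} {a : Grassmann q} (ha : Grassmann.body q a = 0) :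
    a ^ (q + 2) = 0 := by
  have h : a ^ (q + 1) ∈ (LinearMap.ker (Grassmann.body q).toLinearMap) ^ (q + 1) :=
    Submodule.pow_mem_pow _ ha _
  rw [Grassmann.body_pow, Submodule.mem_bot] at h
  rw [pow_succ, h, zero_mul]

theorem Grassmann.isUnit {q : ℕ} {a : Grassmann q} (ha : Grassmann.body q a ≠ 0) : IsUnit a := by
  set n := a - algebraMap ℝ _ (Grassmann.body q a) with hn
  have hn0 : Grassmann.body q n = 0 := by rw [hn, map_sub, AlgHom.commutes]; simp
  have hnil : IsNilpotent n := ⟨_, Grassmann.nilpotent hn0⟩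
  have hu : IsUnit (algebraMap ℝ (Grassmann q) (Grassmann.body q a)) := ha.isUnit.map _
  have : a = algebraMap ℝ _ (Grassmann.body q a) + n := by rw [hn]; abel
  rw [this]
  exact hnil.isUnit_add_left_of_commute hu (Algebra.commutes _ _).symm

/-- An auxiliary norm on the Grassmann algebra (all norms are equivalent). -/
noncomputable abbrev Grassmann.normedRing (q : ℕ) : NormedRing (Grassmann q) :=
  letI := Matrix.linftyOpNormedRing (n := Fin (Module.finrank ℝ (Grassmann q))) (α := ℝ)
  NormedRing.induced (Grassmann q) _ (Algebra.leftMulMatrix (Module.finBasis ℝ (Grassmann q)))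
    (Algebra.leftMulMatrix_injective _)

noncomputable abbrev Grassmann.normedAlgebra (q : ℕ) :
    letI := Grassmann.normedRing q
    NormedAlgebra ℝ (Grassmann q) :=
  letI := Matrix.linftyOpNormedRing (n := Fin (Module.finrank ℝ (Grassmann q))) (α := ℝ)
  letI := Matrix.linftyOpNormedAlgebra (R := ℝ) (n := Fin (Module.finrank ℝ (Grassmann q))) (α := ℝ)
  letI := Grassmann.normedRing q
  NormedAlgebra.induced ℝ (Grassmann q) _ (Algebra.leftMulMatrix (Module.finBasis ℝ (Grassmann q)))

theorem IsSupercommutative.exists_proj {A : Type} [Ring A] [Algebra ℝ A]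
    {par : ZMod 2 → Submodule ℝ A} (h : IsSupercommutative par) :
    ∃ L : ZMod 2 → A →ₗ[ℝ] A, (∀ i a, L i a ∈ par i) ∧ ∀ a, L 0 a + L 1 a = a := by
  refine ⟨fun i => if i = 0 then (par 0).projection (par 1) h.isCompl
    else (par 1).projection (par 0) h.isCompl.symm, ?_, ?_⟩
  · intro i a
    fin_cases i
    · exact Submodule.projection_apply_mem _ a
    · exact Submodule.projection_apply_mem _ a
  · intro a
    exact Submodule.projection_add_projection_eq_self h.isCompl a

/-! ### Superringed spaces -/

/-- A superringed space: a topological space with a sheaf of supercommutative `ℝ`-superalgebras. -/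
structure SuperSpace where
  /-- the underlying topological space -/
  carrier : Type
  [top : TopologicalSpace carrier]
  /-- the sections of the structure sheaf -/
  sec : Opens carrier → Type
  [ring : ∀ U, Ring (sec U)]
  [algebra : ∀ U, Algebra ℝ (sec U)]
  /-- the even and odd sections -/
  par : ∀ U, ZMod 2 → Submodule ℝ (sec U)
  supercommutative : ∀ U, IsSupercommutative (par U)
  /-- the restriction maps -/
  res : ∀ {U V : Opens carrier}, U ≤ V → sec V →ₐ[ℝ] sec U
  res_par : ∀ {U V : Opens carrier} (h : U ≤ V) (i : ZMod 2) (s : sec V),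
    s ∈ par V i → res h s ∈ par U i
  res_self : ∀ {U : Opens carrier} (s : sec U), res (le_refl U) s = s
  res_res : ∀ {U V W : Opens carrier} (h : U ≤ V) (h' : V ≤ W) (s : sec W),
    res h (res h' s) = res (h.trans h') s
  eq_of_res : ∀ {ι : Type} (U : ι → Opens carrier) (V : Opens carrier) (hUV : ∀ i, U i ≤ V),
    V ≤ ⨆ i, U i → ∀ s t : sec V, (∀ i, res (hUV i) s = res (hUV i) t) → s = t
  exists_glue : ∀ {ι : Type} (U : ι → Opens carrier) (V : Opens carrier) (hUV : ∀ i, U i ≤ V),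
    V ≤ ⨆ i, U i → ∀ s : ∀ i, sec (U i),
      (∀ i j, res (inf_le_left : U i ⊓ U j ≤ U i) (s i) =
        res (inf_le_right : U i ⊓ U j ≤ U j) (s j)) →
      ∃ t : sec V, ∀ i, res (hUV i) t = s i

attribute [instance] SuperSpace.top SuperSpace.ring SuperSpace.algebra

namespace SuperSpace

/-- A morphism of superringed spaces: a continuous map and a parity preserving morphism of sheaves
of superalgebras from the structure sheaf of the target to the direct image of the structure sheaf
of the source. -/
structure Hom (X Y : SuperSpace) where
  /-- the underlying continuous map -/
  base : C(X.carrier, Y.carrier)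
  /-- the pull-back of sections -/
  pull : ∀ U : Opens Y.carrier, Y.sec U →ₐ[ℝ] X.sec (Opens.comap base U)
  pull_par : ∀ (U : Opens Y.carrier) (i : ZMod 2) (s : Y.sec U),
    s ∈ Y.par U i → pull U s ∈ X.par (Opens.comap base U) i
  pull_res : ∀ {U V : Opens Y.carrier} (h : U ≤ V) (s : Y.sec V),
    pull U (Y.res h s) = X.res (Opens.comap_mono base h) (pull V s)

/-- The identity morphism. -/
def Hom.id (X : SuperSpace) : Hom X X where
  base := ContinuousMap.id _
  pull U := AlgHom.id ℝ (X.sec U)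
  pull_par _ _ _ hs := hs
  pull_res _ _ := rfl

/-- Composition of morphisms: first `f`, then `g`. -/
def Hom.comp {X Y Z : SuperSpace} (f : Hom X Y) (g : Hom Y Z) : Hom X Z where
  base := g.base.comp f.base
  pull U := (f.pull (Opens.comap g.base U)).comp (g.pull U)
  pull_par U i s hs := f.pull_par _ i _ (g.pull_par U i s hs)
  pull_res {U V} h s := by
    change f.pull _ (g.pull U (Y := Z) _) = _
    rw [g.pull_res, f.pull_res]
    rfl

theorem Hom.ext' {X Y : SuperSpace} {f g : Hom X Y} (hb : f.base = g.base)
    (hp : ∀ (U : Opens Y.carrier) (s : Y.sec U),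
      X.res (le_of_eq (by rw [hb])) (f.pull U s) = g.pull U s) : f = g := by
  obtain ⟨fb, fp, h1, h2⟩ := f
  obtain ⟨gb, gp, h3, h4⟩ := g
  obtain rfl : fb = gb := hb
  have : fp = gp := by
    funext U
    ext s
    exact (X.res_self _).symm.trans (hp U s)
  subst this
  rfl

/-- An open immersion: an isomorphism onto an open sub-superspace of the target. -/
def Hom.IsOpenImmersion {X Y : SuperSpace} (f : Hom X Y) : Prop :=
  Topology.IsOpenEmbedding f.base ∧
    ∀ U : Opens Y.carrier, (U : Set Y.carrier) ⊆ Set.range f.base → Function.Bijective (f.pull U)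

end SuperSpace

/-! ### Superdomains and supermanifolds -/

section Superdomain

variable {E : Type} [NormedAddCommGroup E] [NormedSpace ℝ E]

/-- A function on the open set `U` with values in a Grassmann algebra is smooth if all its
components are. -/
def IsSmooth {U : Opens E} {q : ℕ} (f : U → Grassmann q) : Prop :=
  ∀ ℓ : Grassmann q →ₗ[ℝ] ℝ,
    ContDiffOn ℝ ∞ (Function.extend Subtype.val (fun x => ℓ (f x)) 0) (U : Set E)

section Norm

attribute [local instance] Grassmann.normedRing Grassmann.normedAlgebra

/-- extension by zero -/
noncomputable def ext0 {E : Type} [TopologicalSpace E] {U : Opens E} {q : ℕ} (f : U → Grassmann q) : E → Grassmann q :=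
  Function.extend Subtype.val f 0

theorem ext0_apply {E : Type} [TopologicalSpace E] {U : Opens E} {q : ℕ} (f : U → Grassmann q) (x : U) : ext0 f x = f x :=
  Subtype.val_injective.extend_apply _ _ _

theorem contDiffOn_iff_linear {q : ℕ} {U : Set E} {F : E → Grassmann q} :
    ContDiffOn ℝ ∞ F U ↔ ∀ ℓ : Grassmann q →ₗ[ℝ] ℝ, ContDiffOn ℝ ∞ (fun x => ℓ (F x)) U := by
  constructor
  · intro h ℓ
    exact (LinearMap.toContinuousLinearMap ℓ).contDiff.comp_contDiffOn h
  · intro h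
    let b := Module.finBasis ℝ (Grassmann q)
    have : F = fun x => ∑ i, b.coord i (F x) • b i := by
      funext x; exact (b.sum_repr (F x)).symm
    rw [this]
    exact ContDiffOn.sum fun i _ => (h (b.coord i)).smul contDiffOn_const

theorem isSmooth_iff {U : Opens E} {q : ℕ} {f : U → Grassmann q} {F : E → Grassmann q}
    (hF : ∀ x : U, F x = f x) : IsSmooth f ↔ ContDiffOn ℝ ∞ F (U : Set E) := by
  rw [contDiffOn_iff_linear]
  refine forall_congr' fun ℓ => contDiffOn_congr fun x hx => ?_
  have := Subtype.val_injective.extend_apply (fun x => ℓ (f x)) 0 (⟨x, hx⟩ : U)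
  rw [this, ← hF ⟨x, hx⟩]

theorem isSmooth_iff_ext0 {U : Opens E} {q : ℕ} {f : U → Grassmann q} :
    IsSmooth f ↔ ContDiffOn ℝ ∞ (ext0 f) (U : Set E) := isSmooth_iff (ext0_apply f)

theorem IsSmooth.mul {U : Opens E} {q : ℕ} {f g : U → Grassmann q} (hf : IsSmooth f)
    (hg : IsSmooth g) : IsSmooth (f * g) :=
  (isSmooth_iff (F := ext0 f * ext0 g) fun x => by simp [ext0_apply]).2
    ((isSmooth_iff_ext0.1 hf).mul (isSmooth_iff_ext0.1 hg))

theorem IsSmooth.add {U : Opens E} {q : ℕ} {f g : U → Grassmann q} (hf : IsSmooth f)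
    (hg : IsSmooth g) : IsSmooth (f + g) :=
  (isSmooth_iff (F := ext0 f + ext0 g) fun x => by simp [ext0_apply]).2
    ((isSmooth_iff_ext0.1 hf).add (isSmooth_iff_ext0.1 hg))

theorem IsSmooth.const {U : Opens E} {q : ℕ} (a : Grassmann q) : IsSmooth (fun _ : U => a) :=
  (isSmooth_iff (F := fun _ => a) fun _ => rfl).2 contDiffOn_const

theorem IsSmooth.linear {U : Opens E} {q : ℕ} {f : U → Grassmann q} (hf : IsSmooth f)
    (L : Grassmann q →ₗ[ℝ] Grassmann q) : IsSmooth (fun x => L (f x)) :=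
  (isSmooth_iff (F := fun x => L (ext0 f x)) fun x => by simp [ext0_apply]).2
    ((LinearMap.toContinuousLinearMap L).contDiff.comp_contDiffOn (isSmooth_iff_ext0.1 hf))

theorem IsSmooth.comp {E' : Type} [NormedAddCommGroup E'] [NormedSpace ℝ E']
    {U : Opens E} {V : Opens E'} {q : ℕ} {f : U → Grassmann q} (hf : IsSmooth f)
    (a : E' → E) (ha : ContDiff ℝ ∞ a) (hV : ∀ x : V, a x ∈ U) :
    IsSmooth (fun x : V => f ⟨a x, hV x⟩) :=
  (isSmooth_iff (F := fun x => ext0 f (a x)) fun x => ext0_apply f ⟨a x, hV x⟩).2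
    ((isSmooth_iff_ext0.1 hf).comp ha.contDiffOn fun x hx => hV ⟨x, hx⟩)

theorem IsSmooth.of_local {U : Opens E} {q : ℕ} {f : U → Grassmann q}
    (h : ∀ x : U, ∃ (V : Opens E) (hVU : V ≤ U), (x : E) ∈ V ∧
      IsSmooth (fun y : V => f ⟨y, hVU y.2⟩)) : IsSmooth f := by
  rw [isSmooth_iff_ext0]
  intro x hx
  obtain ⟨V, hVU, hxV, hs⟩ := h ⟨x, hx⟩
  have h1 : ContDiffOn ℝ ∞ (ext0 f) (V : Set E) :=
    (isSmooth_iff (F := ext0 f) fun y => ext0_apply f ⟨y, hVU y.2⟩).1 hs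
  exact (h1.contDiffAt (V.isOpen.mem_nhds hxV)).contDiffWithinAt

end Norm

variable (E) in
/-- The algebra of smooth functions on `U` with values in the Grassmann algebra. -/
def smoothSections (q : ℕ) (U : Opens E) : Subalgebra ℝ (U → Grassmann q) where
  carrier := {f | IsSmooth f}
  mul_mem' hf hg := IsSmooth.mul hf hg
  add_mem' hf hg := IsSmooth.add hf hg
  algebraMap_mem' r := IsSmooth.const (algebraMap ℝ _ r)

variable (E) in
/-- The superdomain with underlying space `E` and `q` odd coordinates: its functions are the smooth
functions with values in the Grassmann algebra on `q` generators. -/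
def superDomain (q : ℕ) : SuperSpace where
  carrier := E
  sec U := smoothSections E q U
  par U i :=
    { carrier := {f | ∀ x, f.1 x ∈ Grassmann.par q i}
      add_mem' := fun hf hg x => add_mem (hf x) (hg x)
      zero_mem' := fun _ => zero_mem _
      smul_mem' := fun c _ hf x => Submodule.smul_mem _ c (hf x) }
  supercommutative U :=
    { isCompl := by
        have hc := (Grassmann.isSupercommutative q).isCompl
        constructor
        · rw [Submodule.disjoint_def]
          intro f h0 h1
          refine Subtype.ext (funext fun x => ?_)
          exact (Submodule.disjoint_def.1 hc.disjoint) _ (h0 x) (h1 x)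
        · rw [codisjoint_iff, eq_top_iff]
          intro f _
          rw [Submodule.mem_sup]
          obtain ⟨L, hL, hL'⟩ := (Grassmann.isSupercommutative q).exists_proj
          exact ⟨⟨fun x => L 0 (f.1 x), IsSmooth.linear f.2 _⟩, fun x => hL 0 _,
            ⟨fun x => L 1 (f.1 x), IsSmooth.linear f.2 _⟩, fun x => hL 1 _,
            Subtype.ext (funext fun x => hL' _)⟩
      one_mem := fun _ => (Grassmann.isSupercommutative q).one_mem
      mul_mem := fun ha hb x => (Grassmann.isSupercommutative q).mul_mem (ha x) (hb x)
      even_comm := fun ha b => Subtype.ext <| funext fun x =>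
        (Grassmann.isSupercommutative q).even_comm (ha x) (b.1 x)
      odd_anticomm := fun ha hb => Subtype.ext <| funext fun x =>
        (Grassmann.isSupercommutative q).odd_anticomm (ha x) (hb x) }
  res {U V} h :=
    { toFun := fun f => ⟨fun x => f.1 ⟨x, h x.2⟩, f.2.comp id contDiff_id fun x => h x.2⟩
      map_one' := rfl
      map_mul' := fun _ _ => rfl
      map_zero' := rfl
      map_add' := fun _ _ => rfl
      commutes' := fun _ => rfl }
  res_par _ _ _ hs x := hs _
  res_self _ := rfl
  res_res _ _ _ := rfl
  eq_of_res U V hUV hV s t hst := by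
    refine Subtype.ext (funext fun x => ?_)
    obtain ⟨i, hi⟩ := Opens.mem_iSup.1 (hV x.2)
    exact congrFun (congrArg Subtype.val (hst i)) ⟨x, hi⟩
  exists_glue U V hUV hV s hs := by
    choose i hi using fun x : V => Opens.mem_iSup.1 (hV x.2)
    have key : ∀ (x : V) (j) (hj : (x : E) ∈ U j), (s (i x)).1 ⟨x, hi x⟩ = (s j).1 ⟨x, hj⟩ :=
      fun x j hj => congrFun (congrArg Subtype.val (hs (i x) j)) ⟨x, hi x, hj⟩
    refine ⟨⟨fun x => (s (i x)).1 ⟨x, hi x⟩, IsSmooth.of_local fun x => ?_⟩, fun j => ?_⟩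
    · refine ⟨U (i x), hUV _, hi x, ?_⟩
      have h2 : IsSmooth (s (i x)).1 := (s (i x)).2
      have h3 : (s (i x)).1 = fun y : U (i x) => (s (i ⟨y, hUV _ y.2⟩)).1 ⟨y, hi ⟨y, hUV _ y.2⟩⟩ :=
        funext fun y => (key ⟨y, hUV _ y.2⟩ (i x) y.2).symm
      rwa [h3] at h2
    · refine Subtype.ext (funext fun x => ?_)
      exact key ⟨x, hUV j x.2⟩ j x.2

/-- A smooth map induces a morphism of superdomains which is the identity on odd coordinates. -/
def superDomain.map {E' : Type} [NormedAddCommGroup E'] [NormedSpace ℝ E'] (q : ℕ) (a : E → E')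
    (ha : ContDiff ℝ ∞ a) : SuperSpace.Hom (superDomain E q) (superDomain E' q) where
  base := ⟨a, ha.continuous⟩
  pull U :=
    { toFun := fun f => ⟨fun x => f.1 ⟨a x, x.2⟩, IsSmooth.comp f.2 a ha fun x => x.2⟩
      map_one' := rfl
      map_mul' := fun _ _ => rfl
      map_zero' := rfl
      map_add' := fun _ _ => rfl
      commutes' := fun _ => rfl }
  pull_par _ _ _ hs x := hs _
  pull_res _ _ := rfl

end Superdomain

section Values

attribute [local instance] Grassmann.normedRing Grassmann.normedAlgebra

variable {E : Type} [NormedAddCommGroup E] [NormedSpace ℝ E] {n : ℕ} {X Y : SuperSpace}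

/-- The pull-back of a section along a morphism from a superdomain, as a function (extended by
zero). -/
noncomputable def ev (χ : SuperSpace.Hom (superDomain E n) X) {U : Opens X.carrier} (s : X.sec U) :
    E → Grassmann n :=
  ext0 (E := E) (U := Opens.comap χ.base U) (χ.pull U s).1

variable (χ : SuperSpace.Hom (superDomain E n) X) {U V : Opens X.carrier}

theorem ev_apply (s : X.sec U) (v : E) (hv : χ.base v ∈ U) : ev χ s v = (χ.pull U s).1 ⟨v, hv⟩ :=
  ext0_apply (E := E) (U := Opens.comap χ.base U) (χ.pull U s).1 ⟨v, hv⟩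

/-- The value of sections at a point of a superdomain is an algebra homomorphism. -/
noncomputable def evHom (U : Opens X.carrier) (v : E) (hv : χ.base v ∈ U) : X.sec U →ₐ[ℝ] Grassmann n where
  toFun s := ev χ s v
  map_one' := by rw [ev_apply χ _ v hv, map_one]; rfl
  map_mul' s t := by rw [ev_apply χ _ v hv, ev_apply χ _ v hv, ev_apply χ _ v hv, map_mul]; rfl
  map_zero' := by rw [ev_apply χ _ v hv, map_zero]; rfl
  map_add' s t := by rw [ev_apply χ _ v hv, ev_apply χ _ v hv, ev_apply χ _ v hv, map_add]; rfl
  commutes' r := by rw [ev_apply χ _ v hv, AlgHom.commutes]; rfl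

theorem evHom_apply (v : E) (hv : χ.base v ∈ U) (s : X.sec U) : evHom χ U v hv s = ev χ s v := rfl

theorem ev_smooth (s : X.sec U) : ContDiffOn ℝ ∞ (ev χ s) {v | χ.base v ∈ U} :=
  (isSmooth_iff_ext0 (E := E) (U := Opens.comap χ.base U)).1 (χ.pull U s).2

theorem ev_res (h : U ≤ V) (s : X.sec V) (v : E) (hv : χ.base v ∈ U) :
    ev χ (X.res h s) v = ev χ s v := by
  rw [ev_apply χ _ v hv, ev_apply χ _ v (h hv), χ.pull_res]
  rfl

theorem ev_comp (f : SuperSpace.Hom X Y) {U : Opens Y.carrier} (s : Y.sec U) :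
    ev (χ.comp f) s = ev χ (f.pull U s) := rfl

theorem ev_par {i : ZMod 2} {s : X.sec U} (hs : s ∈ X.par U i) (v : E) :
    ev χ s v ∈ Grassmann.par n i := by
  by_cases hv : χ.base v ∈ U
  · rw [ev_apply χ _ v hv]
    exact χ.pull_par U i s hs ⟨v, hv⟩
  · unfold ev ext0
    rw [Function.extend_apply']
    · exact zero_mem _
    · rintro ⟨x, rfl⟩
      exact hv x.2

theorem isOpen_pre (U : Opens X.carrier) : IsOpen {v : E | χ.base v ∈ U} :=
  U.isOpen.preimage χ.base.continuous

variable {χ}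

/-- Over the image of an open immersion, sections are the same as smooth functions. -/
theorem exists_section (hχ : χ.IsOpenImmersion) (hU : (U : Set X.carrier) ⊆ Set.range χ.base)
    (F : E → Grassmann n) (hF : ContDiffOn ℝ ∞ F {v | χ.base v ∈ U}) :
    ∃ s : X.sec U, ∀ v : E, χ.base v ∈ U → ev χ s v = F v := by
  obtain ⟨s, hs⟩ := (hχ.2 U hU).2 ⟨fun v => F v.1,
    (isSmooth_iff (E := E) (U := Opens.comap χ.base U) (F := F) fun v => rfl).2 hF⟩
  refine ⟨s, fun v hv => ?_⟩
  rw [ev_apply χ _ v hv, hs]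

theorem section_ext (hχ : χ.IsOpenImmersion) (hU : (U : Set X.carrier) ⊆ Set.range χ.base)
    {s t : X.sec U} (h : ∀ v : E, χ.base v ∈ U → ev χ s v = ev χ t v) : s = t := by
  refine (hχ.2 U hU).1 (Subtype.ext (funext fun v => ?_))
  have := h v.1 v.2
  rwa [ev_apply χ _ v.1 v.2, ev_apply χ _ v.1 v.2] at this

theorem section_par (hχ : χ.IsOpenImmersion) (hU : (U : Set X.carrier) ⊆ Set.range χ.base)
    {s : X.sec U} {i : ZMod 2} (h : ∀ v : E, χ.base v ∈ U → ev χ s v ∈ Grassmann.par n i) :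
    s ∈ X.par U i := by
  obtain ⟨L, hL, hL'⟩ := (X.supercommutative U).exists_proj
  have hc := (Grassmann.isSupercommutative n).isCompl
  have hadd : ∀ v : E, χ.base v ∈ U → ev χ (L 0 s) v + ev χ (L 1 s) v = ev χ s v := by
    intro v hv
    conv_rhs => rw [← hL' s]
    exact (map_add (evHom χ U v hv) _ _).symm
  have hcase : s = L i s := by
    refine section_ext hχ hU fun (v : E) hv => ?_
    have h0 := ev_par χ (hL 0 s) v
    have h1 := ev_par χ (hL 1 s) v
    have hs := h v hv
    have ha := hadd v hv
    fin_cases i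
    · have h2 : ev χ (L 1 s) v ∈ Grassmann.par n 0 := by
        rw [eq_sub_of_add_eq' ha]; exact sub_mem hs h0
      have := (Submodule.disjoint_def.1 hc.disjoint) _ h2 h1
      rw [this, add_zero] at ha
      exact ha.symm
    · have h2 : ev χ (L 0 s) v ∈ Grassmann.par n 1 := by
        rw [eq_sub_of_add_eq ha]; exact sub_mem hs h1
      have := (Submodule.disjoint_def.1 hc.disjoint) _ h0 h2
      rw [this, zero_add] at ha
      exact ha.symm
  rw [hcase]
  exact hL i s

/-- The image of an open set under an open immersion. -/
def imageOpen (hχ : χ.IsOpenImmersion) {D : Set E} (hD : IsOpen D) : Opens X.carrier :=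
  ⟨χ.base '' D, hχ.1.isOpenMap _ hD⟩

theorem base_mem_imageOpen (hχ : χ.IsOpenImmersion) {D : Set E} (hD : IsOpen D) (v : E) :
    χ.base v ∈ imageOpen hχ hD ↔ v ∈ D :=
  ⟨fun ⟨_, hw, h⟩ => hχ.1.injective h ▸ hw, fun h => ⟨v, h, rfl⟩⟩

theorem imageOpen_range (hχ : χ.IsOpenImmersion) {D : Set E} (hD : IsOpen D) :
    (imageOpen hχ hD : Set X.carrier) ⊆ Set.range χ.base := Set.image_subset_range _ _

/-- Compatibility of the pull-back with the body. -/
theorem body_ev {E' : Type} [NormedAddCommGroup E'] [NormedSpace ℝ E'] {m : ℕ}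
    (hχ : χ.IsOpenImmersion) (κ : SuperSpace.Hom (superDomain E' m) X) (s : X.sec U)
    (v : E') (y : E) (hvy : κ.base v = χ.base y) (hv : κ.base v ∈ U) :
    Grassmann.body m (ev κ s v) = Grassmann.body n (ev χ s y) := by
  set c := Grassmann.body m (ev κ s v) with hc
  by_contra hne
  have hyU : χ.base y ∈ U := hvy ▸ hv
  have hbs : ContinuousOn (fun w => Grassmann.body n (ev χ s w)) {w | χ.base w ∈ U} :=
    (LinearMap.toContinuousLinearMap (Grassmann.body n).toLinearMap).continuous.comp_continuousOn
      (ev_smooth χ s).continuousOn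
  set D : Set E := {w | χ.base w ∈ U} ∩ (fun w => Grassmann.body n (ev χ s w)) ⁻¹' {c}ᶜ with hD
  have hDo : IsOpen D := hbs.isOpen_inter_preimage (isOpen_pre χ U) isOpen_compl_singleton
  have hOU : imageOpen hχ hDo ≤ U := by rintro _ ⟨w, hw, rfl⟩; exact hw.1
  have hyD : y ∈ D := ⟨hyU, fun h => hne h.symm⟩
  have hvO : κ.base v ∈ imageOpen hχ hDo := hvy ▸ (base_mem_imageOpen hχ hDo y).2 hyD
  set s' := X.res hOU s - algebraMap ℝ _ c with hs'
  have hev : ∀ w ∈ D, ev χ s' w = ev χ s w - algebraMap ℝ _ c := by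
    intro w hw
    have hwO := (base_mem_imageOpen hχ hDo w).2 hw
    rw [← evHom_apply χ w hwO, hs', map_sub, AlgHom.commutes, evHom_apply, ev_res χ _ _ _ hwO]
  have hunit : ∀ w ∈ D, IsUnit (ev χ s' w) := by
    intro w hw
    refine Grassmann.isUnit ?_
    rw [hev w hw, map_sub, AlgHom.commutes, sub_ne_zero]
    exact hw.2
  have hsm : ContDiffOn ℝ ∞ (fun w => Ring.inverse (ev χ s' w)) {w | χ.base w ∈ imageOpen hχ hDo} := by
    intro w hw
    obtain ⟨u, hu⟩ := hunit w ((base_mem_imageOpen hχ hDo w).1 hw)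
    have : CompleteSpace (Grassmann n) := FiniteDimensional.complete ℝ _
    have h1 : ContDiffAt ℝ ∞ Ring.inverse (ev χ s' w) := hu ▸ contDiffAt_ringInverse ℝ u
    exact h1.comp_contDiffWithinAt w ((ev_smooth χ s') w hw)
  obtain ⟨r, hr⟩ := exists_section hχ (imageOpen_range hχ hDo) _ hsm
  have hmul : s' * r = 1 := by
    refine section_ext hχ (imageOpen_range hχ hDo) fun (w : E) hw => ?_
    rw [← evHom_apply χ w hw, ← evHom_apply χ w hw, map_mul, map_one, evHom_apply, evHom_apply, hr w hw]
    exact Ring.mul_inverse_cancel _ (hunit w ((base_mem_imageOpen hχ hDo w).1 hw))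
  have h1 : Grassmann.body m (evHom κ _ v hvO (s' * r)) = 1 := by rw [hmul, map_one, map_one]
  rw [map_mul, map_mul, hs', map_sub, AlgHom.commutes, evHom_apply, ev_res κ _ _ _ hvO, map_sub,
    AlgHom.commutes, ← hc] at h1
  simp at h1

variable [FiniteDimensional ℝ E]

theorem exists_cutoff {F : Type} [NormedAddCommGroup F] [NormedSpace ℝ F]
    {E : Type} [NormedAddCommGroup E] [NormedSpace ℝ E] [FiniteDimensional ℝ E]
    {W : Set E} (hW : IsOpen W) {f : E → F} (hf : ContDiffOn ℝ ∞ f W) {x : E} (hx : x ∈ W) :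
    ∃ g : E → F, ContDiff ℝ ∞ g ∧ ∀ᶠ y in nhds x, g y = f y := by
  obtain ⟨ε, hε, hεW⟩ := Metric.isOpen_iff.1 hW x hx
  let ψ : ContDiffBump x := ⟨ε / 3, ε / 2, by linarith, by linarith⟩
  have hts : tsupport ψ ⊆ W := by
    rw [ψ.tsupport_eq]
    exact (Metric.closedBall_subset_ball (by change ε / 2 < ε; linarith)).trans hεW
  refine ⟨fun y => ψ y • f y, ?_, ?_⟩
  · rw [contDiff_iff_contDiffAt]
    intro y
    by_cases hy : y ∈ W
    · exact ψ.contDiffAt.smul (hf.contDiffAt (hW.mem_nhds hy))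
    · have h1 : (tsupport ψ)ᶜ ∈ nhds y := (isClosed_tsupport ψ).isOpen_compl.mem_nhds fun h => hy (hts h)
      refine (contDiffAt_const (c := (0 : F))).congr_of_eventuallyEq ?_
      filter_upwards [h1] with z hz
      rw [image_eq_zero_of_notMem_tsupport hz, zero_smul]
  · filter_upwards [ψ.eventuallyEq_one] with y hy
    rw [hy, Pi.one_apply, one_smul]

/-- Smooth families of functions on a superdomain pull back to smooth families. -/
theorem family_contDiffAt {E' : Type} [NormedAddCommGroup E'] [NormedSpace ℝ E'] {m : ℕ}
    (hχ : χ.IsOpenImmersion) (κ : SuperSpace.Hom (superDomain E' m) X)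
    {W : Set (X.carrier × ℝ)} (hW : IsOpen W) (Wt : ℝ → Opens X.carrier)
    (hWt : ∀ t x, x ∈ Wt t ↔ (x, t) ∈ W) (f : ∀ t, X.sec (Wt t))
    (hf : ContDiffOn ℝ ∞ (fun p : E × ℝ => ev χ (f p.2) p.1) {p | (χ.base p.1, p.2) ∈ W})
    (v₀ : E') (t₀ : ℝ) (h₀ : (κ.base v₀, t₀) ∈ W) (hr : κ.base v₀ ∈ Set.range χ.base) :
    ContDiffAt ℝ ∞ (fun p : E' × ℝ => ev κ (f p.2) p.1) (v₀, t₀) := by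
  obtain ⟨(y₀ : E), hy₀⟩ := hr
  set W' : Set (E × ℝ) := {p | (χ.base p.1, p.2) ∈ W} with hW'
  have hχc : Continuous fun p : E × ℝ => (χ.base p.1, p.2) :=
    (χ.base.continuous.comp continuous_fst).prodMk continuous_snd
  have hW'o : IsOpen W' := hW.preimage hχc
  have hyW : (y₀, t₀) ∈ W' := by
    change (χ.base y₀, t₀) ∈ W
    rw [hy₀]; exact h₀
  obtain ⟨G, hGs, hG⟩ := exists_cutoff hW'o hf hyW
  obtain ⟨M, hM, hMo, hyM⟩ := mem_nhds_iff.1 (Filter.inter_mem hG (hW'o.mem_nhds hyW))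
  set A : Subalgebra ℝ (E → Grassmann n) :=
    { carrier := {g | ContDiff ℝ ∞ g}
      mul_mem' := fun {a b} (ha : ContDiff ℝ ∞ a) (hb : ContDiff ℝ ∞ b) =>
        (ContDiff.mul ha hb : ContDiff ℝ ∞ (a * b))
      add_mem' := fun {a b} (ha : ContDiff ℝ ∞ a) (hb : ContDiff ℝ ∞ b) =>
        (ContDiff.add ha hb : ContDiff ℝ ∞ (a + b))
      algebraMap_mem' := fun r =>
        (contDiff_const : ContDiff ℝ ∞ (fun _ : E => algebraMap ℝ (Grassmann n) r)) } with hA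
  set R : Opens X.carrier := imageOpen hχ isOpen_univ with hR
  have hRr : (R : Set X.carrier) ⊆ Set.range χ.base := imageOpen_range hχ _
  have hRm : ∀ w : E, χ.base w ∈ R := fun w => (base_mem_imageOpen hχ _ w).2 trivial
  choose σ₀ hσ₀ using fun g : A => exists_section hχ hRr g.1 (ContDiff.contDiffOn g.2)
  let σ : A →ₐ[ℝ] X.sec R :=
    { toFun := σ₀
      map_one' := section_ext hχ hRr fun (w : E) hw => by
        rw [hσ₀ _ _ hw, ← evHom_apply χ w hw, map_one]; rfl
      map_zero' := section_ext hχ hRr fun (w : E) hw => by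
        rw [hσ₀ _ _ hw, ← evHom_apply χ w hw, map_zero]; rfl
      map_mul' := fun a b => section_ext hχ hRr fun (w : E) hw => by
        rw [hσ₀ _ _ hw, ← evHom_apply χ w hw, map_mul, evHom_apply, evHom_apply, hσ₀ _ _ hw,
          hσ₀ _ _ hw]; rfl
      map_add' := fun a b => section_ext hχ hRr fun (w : E) hw => by
        rw [hσ₀ _ _ hw, ← evHom_apply χ w hw, map_add, evHom_apply, evHom_apply, hσ₀ _ _ hw,
          hσ₀ _ _ hw]; rfl
      commutes' := fun r => section_ext hχ hRr fun (w : E) hw => by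
        rw [hσ₀ _ _ hw, ← evHom_apply χ w hw, AlgHom.commutes]; rfl }
  have hσ : ∀ (g : A) (w : E), ev χ (σ g) w = g.1 w := fun g w => hσ₀ g w (hRm w)
  set B : Set E' := {v | κ.base v ∈ R} with hB
  have hBo : IsOpen B := isOpen_pre κ R
  have hβ₀ : ∀ v : E', ∃ y : E, v ∈ B → κ.base v = χ.base y := by
    intro v
    by_cases hv : v ∈ B
    · obtain ⟨y, hy⟩ := hRr hv
      exact ⟨y, fun _ => hy.symm⟩
    · exact ⟨0, fun h => absurd h hv⟩
  choose β hβ using hβ₀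
  have hbody : ∀ v ∈ B, ∀ g : A, Grassmann.body m (ev κ (σ g) v) = Grassmann.body n (g.1 (β v)) := by
    intro v hv g
    rw [body_ev hχ κ (σ g) v (β v) (hβ v hv) hv, hσ]
  have hv₀B : v₀ ∈ B := by
    change κ.base v₀ ∈ R
    rw [← hy₀]; exact hRm _
  classical
  let K : E' → A →ₐ[ℝ] Grassmann m := fun v =>
    if h : κ.base v ∈ R then (evHom κ R v h).comp σ else (evHom κ R v₀ hv₀B).comp σ
  have hKe : ∀ v ∈ B, ∀ g : A, K v g = ev κ (σ g) v := by
    intro v hv g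
    have : K v = (evHom κ R v hv).comp σ := dif_pos hv
    rw [this]; rfl
  have hβs : ContDiffOn ℝ ∞ β B := by
    let b := Module.finBasis ℝ E
    have hsum : β = fun v => ∑ i, b.coord i (β v) • b i := by
      funext v; exact (b.sum_repr (β v)).symm
    rw [hsum]
    refine ContDiffOn.sum fun i _ => ContDiffOn.fun_smul ?_ contDiffOn_const
    let co : A := ⟨fun y => algebraMap ℝ _ (b.coord i y), by
      change ContDiff ℝ ∞ _
      simp only [Algebra.algebraMap_eq_smul_one]
      exact ((LinearMap.toContinuousLinearMap (b.coord i)).contDiff).smul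
        (contDiff_const (c := (1 : Grassmann n)))⟩
    have h1 : ContDiffOn ℝ ∞ (fun v => Grassmann.body m (ev κ (σ co) v)) B :=
      (LinearMap.toContinuousLinearMap (Grassmann.body m).toLinearMap).contDiff.comp_contDiffOn
        (ev_smooth κ (σ co))
    refine h1.congr fun v hv => ?_
    rw [hbody v hv]
    exact ((Grassmann.body n).commutes _).symm
  obtain ⟨S, hS, hS'⟩ := smooth_family A (fun f => Iff.rfl)
    (LinearMap.ker (Grassmann.body m).toLinearMap) (Grassmann.body_pow m) K
    (fun g => (ev_smooth κ (σ g)).congr fun v hv => hKe v hv g) β hβs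
    (by
      intro v hv ℓ g hg
      rw [hKe v hv]
      change Grassmann.body m (ev κ (σ g) v) = 0
      rw [hbody v hv, hg]
      change Grassmann.body n (algebraMap ℝ _ (ℓ (β v - β v))) = 0
      rw [sub_self, map_zero, map_zero, map_zero]) G hGs
  have hev : ∀ᶠ p : E' × ℝ in nhds (v₀, t₀), ev κ (f p.2) p.1 = S p := by
    have hβ0 : β v₀ = y₀ := hχ.1.injective (by rw [← hβ v₀ hv₀B, hy₀])
    have hc : ContinuousAt (fun p : E' × ℝ => (β p.1, p.2)) (v₀, t₀) := by
      have h1 : ContinuousAt β v₀ := hβs.continuousOn.continuousAt (hBo.mem_nhds hv₀B)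
      exact ContinuousAt.prodMk (ContinuousAt.comp (f := Prod.fst) (x := (v₀, t₀)) h1 continuousAt_fst)
        continuousAt_snd
    have h1 : ∀ᶠ p : E' × ℝ in nhds (v₀, t₀), (β p.1, p.2) ∈ M :=
      hc (hMo.mem_nhds (by change (β v₀, t₀) ∈ M; rw [hβ0]; exact hyM))
    have h2 : ∀ᶠ p : E' × ℝ in nhds (v₀, t₀), p.1 ∈ B :=
      continuousAt_fst (hBo.mem_nhds hv₀B)
    filter_upwards [h1, h2]
    rintro ⟨v, t⟩ hvM hvB
    let g : A := ⟨fun y => G (y, t), hGs.comp (contDiff_id.prodMk contDiff_const)⟩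
    change ev κ (f t) v = S (v, t)
    rw [← hS' v hvB t g rfl, hKe v hvB]
    have hDo : IsOpen {y : E | (y, t) ∈ M} := hMo.preimage (by fun_prop : Continuous fun y : E => (y, t))
    have hO1 : imageOpen hχ hDo ≤ Wt t := by
      rintro _ ⟨y, hy, rfl⟩
      exact (hWt t _).2 (hM hy).2
    have hO2 : imageOpen hχ hDo ≤ R := by
      rintro _ ⟨y, hy, rfl⟩
      exact hRm y
    have hvO : κ.base v ∈ imageOpen hχ hDo := by
      rw [hβ v hvB]
      exact (base_mem_imageOpen hχ hDo _).2 hvM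
    have heq : X.res hO1 (f t) = X.res hO2 (σ g) := by
      refine section_ext hχ (imageOpen_range hχ hDo) fun (w : E) hw => ?_
      rw [ev_res χ _ _ _ hw, ev_res χ _ _ _ hw, hσ]
      exact ((hM ((base_mem_imageOpen hχ hDo w).1 hw)).1).symm
    rw [← ev_res κ hO1 _ _ hvO, heq, ev_res κ hO2 _ _ hvO]
  exact ((hS.contDiffAt ((hBo.prod isOpen_univ).mem_nhds ⟨hv₀B, trivial⟩)).congr_of_eventuallyEq hev)

end Values

section Product

set_option linter.unusedVariables false

attribute [local instance] Grassmann.normedRing Grassmann.normedAlgebra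

theorem Grassmann.proj_unique {n : ℕ} {L : ZMod 2 → Grassmann n →ₗ[ℝ] Grassmann n}
    (hL : ∀ i a, L i a ∈ Grassmann.par n i) (hL' : ∀ a, L 0 a + L 1 a = a) (a : ZMod 2 → Grassmann n)
    (ha : ∀ i, a i ∈ Grassmann.par n i) (i : ZMod 2) : L i (a 0 + a 1) = a i := by
  have hc := (Grassmann.isSupercommutative n).isCompl
  have h := hL' (a 0 + a 1)
  have e : L 0 (a 0 + a 1) - a 0 = a 1 - L 1 (a 0 + a 1) := by
    rw [sub_eq_sub_iff_add_eq_add, h, add_comm]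
  have h0 : L 0 (a 0 + a 1) - a 0 = 0 := by
    refine (Submodule.disjoint_def.1 hc.disjoint) _ (sub_mem (hL 0 _) (ha 0)) ?_
    rw [e]; exact sub_mem (ha 1) (hL 1 _)
  rw [h0] at e
  fin_cases i
  · exact sub_eq_zero.1 h0
  · exact (sub_eq_zero.1 e.symm).symm

variable (X : SuperSpace)

/-- The slice of an open subset of `X × ℝ` at time `t`. -/
def slice {X : SuperSpace} (W : Opens (X.carrier × ℝ)) (t : ℝ) : Opens X.carrier :=
  Opens.comap ⟨fun x => (x, t), by fun_prop⟩ W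

variable {X}

theorem mem_slice {W : Opens (X.carrier × ℝ)} {t : ℝ} {x : X.carrier} :
    x ∈ slice W t ↔ (x, t) ∈ W := Iff.rfl

theorem slice_mono {U W : Opens (X.carrier × ℝ)} (h : U ≤ W) (t : ℝ) : slice U t ≤ slice W t :=
  fun _ hx => h hx

/-- Smooth families of sections. -/
def IsSmoothFamily {W : Opens (X.carrier × ℝ)} (f : ∀ t, X.sec (slice W t)) : Prop :=
  ∀ (E : Type) [NormedAddCommGroup E] [NormedSpace ℝ E] (n : ℕ)
    (χ : SuperSpace.Hom (superDomain E n) X),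
    ContDiffOn ℝ ∞ (fun p : E × ℝ => ev χ (f p.2) p.1) {p | (χ.base p.1, p.2) ∈ W}

variable (X) in
/-- The algebra of smooth families of sections. -/
def families (W : Opens (X.carrier × ℝ)) : Subalgebra ℝ (∀ t, X.sec (slice W t)) where
  carrier := {f | IsSmoothFamily f}
  mul_mem' {f g} hf hg := fun E _ _ n χ => by
    refine ((hf E n χ).mul (hg E n χ)).congr fun p hp => ?_
    exact map_mul (evHom χ (slice W p.2) p.1 hp) _ _
  add_mem' {f g} hf hg := fun E _ _ n χ => by
    refine ((hf E n χ).add (hg E n χ)).congr fun p hp => ?_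
    exact map_add (evHom χ (slice W p.2) p.1 hp) _ _
  algebraMap_mem' r := fun E _ _ n χ => by
    refine (contDiffOn_const (c := algebraMap ℝ (Grassmann n) r)).congr fun p hp => ?_
    exact AlgHom.commutes (evHom χ (slice W p.2) p.1 hp) r

variable {E : Type} [NormedAddCommGroup E] [NormedSpace ℝ E] {n : ℕ}

theorem isOpen_plot (χ : SuperSpace.Hom (superDomain E n) X) (W : Opens (X.carrier × ℝ)) :
    IsOpen {p : E × ℝ | (χ.base p.1, p.2) ∈ W} :=
  W.isOpen.preimage ((χ.base.continuous.comp continuous_fst).prodMk continuous_snd)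

variable (X) in
/-- The product of a superringed space with the real line (with smooth families as functions). -/
def prodLine : SuperSpace where
  carrier := X.carrier × ℝ
  sec W := families X W
  par W i :=
    { carrier := {f | ∀ t, f.1 t ∈ X.par _ i}
      add_mem' := fun hf hg t => add_mem (hf t) (hg t)
      zero_mem' := fun _ => zero_mem _
      smul_mem' := fun c _ hf t => Submodule.smul_mem _ c (hf t) }
  supercommutative W :=
    { isCompl := by
        constructor
        · rw [Submodule.disjoint_def]
          intro f h0 h1
          refine Subtype.ext (funext fun t => ?_)
          exact (Submodule.disjoint_def.1 (X.supercommutative (slice W t)).isCompl.disjoint) _ (h0 t) (h1 t)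
        · rw [codisjoint_iff, eq_top_iff]
          intro f _
          rw [Submodule.mem_sup]
          choose L hL hL' using fun t => (X.supercommutative (slice W t)).exists_proj
          have hsm : ∀ i, IsSmoothFamily fun t => L t i (f.1 t) := by
            intro i E _ _ n χ
            obtain ⟨Λ, hΛ, hΛ'⟩ := (Grassmann.isSupercommutative n).exists_proj
            refine ((LinearMap.toContinuousLinearMap (Λ i)).contDiff.comp_contDiffOn
              (f.2 E n χ)).congr fun p hp => ?_
            have h1 := Grassmann.proj_unique hΛ hΛ' (fun j => ev χ (L p.2 j (f.1 p.2)) p.1)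
              (fun j => ev_par χ (hL p.2 j _) p.1) i
            have h2 : ev χ (L p.2 0 (f.1 p.2)) p.1 + ev χ (L p.2 1 (f.1 p.2)) p.1 = ev χ (f.1 p.2) p.1 := by
              conv_rhs => rw [← hL' p.2 (f.1 p.2)]
              exact (map_add (evHom χ (slice W p.2) p.1 hp) _ _).symm
            rw [h2] at h1
            exact h1.symm
          exact ⟨⟨fun t => L t 0 (f.1 t), hsm 0⟩, fun t => hL t 0 _,
            ⟨fun t => L t 1 (f.1 t), hsm 1⟩, fun t => hL t 1 _,
            Subtype.ext (funext fun t => hL' t _)⟩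
      one_mem := fun t => (X.supercommutative (slice W t)).one_mem
      mul_mem := fun ha hb t => (X.supercommutative (slice W t)).mul_mem (ha t) (hb t)
      even_comm := fun ha b => Subtype.ext <| funext fun t =>
        (X.supercommutative (slice W t)).even_comm (ha t) (b.1 t)
      odd_anticomm := fun ha hb => Subtype.ext <| funext fun t =>
        (X.supercommutative (slice W t)).odd_anticomm (ha t) (hb t) }
  res {U V} h :=
    { toFun := fun f => ⟨fun t => X.res (slice_mono h t) (f.1 t), fun E _ _ n χ =>
        ((f.2 E n χ).mono fun p hp => h hp).congr fun p hp => ev_res χ _ _ _ hp⟩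
      map_one' := Subtype.ext <| funext fun t => map_one _
      map_mul' := fun _ _ => Subtype.ext <| funext fun t => map_mul _ _ _
      map_zero' := Subtype.ext <| funext fun t => map_zero _
      map_add' := fun _ _ => Subtype.ext <| funext fun t => map_add _ _ _
      commutes' := fun r => Subtype.ext <| funext fun t => AlgHom.commutes _ r }
  res_par _ _ _ hs t := X.res_par _ _ _ (hs t)
  res_self s := Subtype.ext <| funext fun t => X.res_self _
  res_res _ _ s := Subtype.ext <| funext fun t => X.res_res _ _ _
  eq_of_res U V hUV hV s s' hst := by
    refine Subtype.ext (funext fun t => ?_)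
    refine X.eq_of_res (fun i => slice (U i) t) _ (fun i => slice_mono (hUV i) t) ?_ _ _ fun i => ?_
    · intro x hx
      obtain ⟨i, hi⟩ := Opens.mem_iSup.1 (hV hx)
      exact Opens.mem_iSup.2 ⟨i, hi⟩
    · exact congrFun (congrArg Subtype.val (hst i)) t
  exists_glue U V hUV hV s hs := by
    have hcov : ∀ t, slice V t ≤ ⨆ i, slice (U i) t := by
      intro t x hx
      obtain ⟨i, hi⟩ := Opens.mem_iSup.1 (hV hx)
      exact Opens.mem_iSup.2 ⟨i, hi⟩
    have hex : ∀ t, ∃ f : X.sec (slice V t), ∀ i, X.res (slice_mono (hUV i) t) f = (s i).1 t := by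
      intro t
      refine X.exists_glue (fun i => slice (U i) t) _ (fun i => slice_mono (hUV i) t) (hcov t)
        (fun i => (s i).1 t) fun i j => ?_
      have h1 : X.res _ ((s i).1 t) = X.res _ ((s j).1 t) := congrFun (congrArg Subtype.val (hs i j)) t
      have hle : slice (U i) t ⊓ slice (U j) t ≤ slice (U i ⊓ U j) t := fun x hx => hx
      have h2 := congrArg (X.res hle) h1
      rw [X.res_res, X.res_res] at h2
      exact h2
    choose f hf using hex
    refine ⟨⟨f, fun E _ _ n χ => ?_⟩, fun i => Subtype.ext (funext fun t => hf t i)⟩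
    intro p hp
    obtain ⟨i, hi⟩ := Opens.mem_iSup.1 (hV hp)
    have h1 := ((s i).2 E n χ).contDiffAt ((isOpen_plot χ (U i)).mem_nhds hi)
    refine (h1.congr_of_eventuallyEq ?_).contDiffWithinAt
    filter_upwards [(isOpen_plot χ (U i)).mem_nhds hi] with q hq
    rw [← hf q.2 i, ev_res χ _ _ _ hq]

/-- Evaluation of families at a point and a time. -/
noncomputable def evAt (χ : SuperSpace.Hom (superDomain E n) X) (W : Opens (prodLine X).carrier) (v : E)
    (t : ℝ) (h : (χ.base v, t) ∈ W) : (prodLine X).sec W →ₐ[ℝ] Grassmann n :=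
  ((evHom χ (slice W t) v h).comp (Pi.evalAlgHom ℝ _ t)).comp (families X W).val

theorem evAt_apply (χ : SuperSpace.Hom (superDomain E n) X) (W : Opens (prodLine X).carrier) (v : E)
    (t : ℝ) (h : (χ.base v, t) ∈ W) (f : (prodLine X).sec W) : evAt χ W v t h f = ev χ (f.1 t) v := rfl

theorem evAt_res (χ : SuperSpace.Hom (superDomain E n) X) {U W : Opens (prodLine X).carrier} (hUW : U ≤ W)
    (v : E) (t : ℝ) (h : (χ.base v, t) ∈ U) (f : (prodLine X).sec W) :
    evAt χ U v t h ((prodLine X).res hUW f) = evAt χ W v t (hUW h) f :=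
  ev_res χ (slice_mono hUW t) (f.1 t) v h

theorem sec_eq_of_empty {U : Opens X.carrier} (hU : ∀ x, x ∉ U) (s t : X.sec U) : s = t :=
  X.eq_of_res (ι := Empty) (fun i => i.elim) U (fun i => i.elim) (fun x hx => absurd hx (hU x)) s t
    (fun i => i.elim)

theorem Grassmann.eq_body_zero (a : Grassmann 0) : a = algebraMap ℝ _ (Grassmann.body 0 a) := by
  have h : a - algebraMap ℝ _ (Grassmann.body 0 a) ∈
      LinearMap.ker (Grassmann.body 0).toLinearMap := by
    change Grassmann.body 0 _ = 0
    rw [map_sub, AlgHom.commutes]; simp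
  have h2 := Grassmann.body_pow 0
  rw [zero_add, pow_one] at h2
  rw [h2, Submodule.mem_bot, sub_eq_zero] at h
  exact h

theorem Grassmann.body_odd {a : Grassmann n} (ha : a ∈ Grassmann.par n 1) : Grassmann.body n a = 0 := by
  have h := (Grassmann.isSupercommutative n).odd_anticomm ha ha
  have h2 := congrArg (Grassmann.body n) h
  rw [map_neg, map_mul] at h2
  exact mul_self_eq_zero.1 (by linarith)

variable (X) in
/-- The constant family at a given time. -/
def fstVal (U : Opens X.carrier) (t : ℝ) :
    X.sec U →ₐ[ℝ] X.sec (slice (X := X) (Opens.comap ⟨Prod.fst, continuous_fst⟩ U) t) :=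
  X.res (fun x hx => hx)

variable (X) in
/-- Constant families. -/
def fstPull (U : Opens X.carrier) : X.sec U →ₐ[ℝ] families X (Opens.comap ⟨Prod.fst, continuous_fst⟩ U) where
  toFun s := ⟨fun t => fstVal X U t s, fun E _ _ n χ =>
        ((ev_smooth χ s).comp contDiffOn_fst fun p hp => hp).congr fun p hp => ev_res χ _ s p.1 hp⟩
  map_one' := Subtype.ext <| funext fun t => map_one _
  map_mul' := fun _ _ => Subtype.ext <| funext fun t => map_mul _ _ _
  map_zero' := Subtype.ext <| funext fun t => map_zero _
  map_add' := fun _ _ => Subtype.ext <| funext fun t => map_add _ _ _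
  commutes' := fun r => Subtype.ext <| funext fun t => AlgHom.commutes (fstVal X U t) r

/-- The first projection. -/
def prodFst (X : SuperSpace) : SuperSpace.Hom (prodLine X) X where
  base := ⟨Prod.fst, continuous_fst⟩
  pull U := fstPull X U
  pull_par U i s hs t := X.res_par _ _ _ hs
  pull_res h s := Subtype.ext <| funext fun t => (X.res_res _ _ _).trans (X.res_res _ _ _).symm

/-- Functions on the line as scalar functions. -/
noncomputable def lineVal {U : Opens ℝ} (t : ℝ) (ht : t ∈ U) : smoothSections ℝ 0 U →ₐ[ℝ] ℝ :=
  ((Grassmann.body 0).comp (Pi.evalAlgHom ℝ (fun _ : U => Grassmann 0) ⟨t, ht⟩)).comp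
    (smoothSections ℝ 0 U).val

open Classical in
variable (X) in
noncomputable def sndVal (U : Opens ℝ) (t : ℝ) : smoothSections ℝ 0 U →ₐ[ℝ]
    X.sec (slice (Opens.comap ⟨Prod.snd, continuous_snd⟩ U) t) :=
  if ht : t ∈ U then (Algebra.ofId ℝ _).comp (lineVal t ht) else
    { toFun := fun _ => 0
      map_one' := sec_eq_of_empty (fun _ hx => ht hx) _ _
      map_mul' := fun _ _ => sec_eq_of_empty (fun _ hx => ht hx) _ _
      map_zero' := sec_eq_of_empty (fun _ hx => ht hx) _ _
      map_add' := fun _ _ => sec_eq_of_empty (fun _ hx => ht hx) _ _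
      commutes' := fun _ => sec_eq_of_empty (fun _ hx => ht hx) _ _ }

theorem sndVal_of_mem {U : Opens ℝ} {t : ℝ} (ht : t ∈ U) (g : smoothSections ℝ 0 U) :
    sndVal X U t g = algebraMap ℝ _ (lineVal t ht g) := by
  rw [sndVal, dif_pos ht]; rfl

variable (X) in
/-- Families of scalars. -/
noncomputable def sndPull (U : Opens ℝ) :
    smoothSections ℝ 0 U →ₐ[ℝ] families X (Opens.comap ⟨Prod.snd, continuous_snd⟩ U) where
  toFun g := ⟨fun t => sndVal X U t g, fun E _ _ n χ => by
    have h1 : ContDiffOn ℝ ∞ (ext0 g.1) (U : Set ℝ) := isSmooth_iff_ext0.1 g.2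
    have h2 : ContDiffOn ℝ ∞ (fun p : E × ℝ =>
        algebraMap ℝ (Grassmann n) (Grassmann.body 0 (ext0 g.1 p.2)))
        {p | (χ.base p.1, p.2) ∈ Opens.comap ⟨Prod.snd, continuous_snd⟩ U} :=
      (LinearMap.toContinuousLinearMap ((Algebra.linearMap ℝ (Grassmann n)).comp
        (Grassmann.body 0).toLinearMap)).contDiff.comp_contDiffOn
        (h1.comp contDiffOn_snd fun p hp => hp)
    refine h2.congr fun p hp => ?_
    have hp' : p.2 ∈ U := hp
    have h3 : ext0 g.1 p.2 = g.1 ⟨p.2, hp'⟩ := ext0_apply g.1 ⟨p.2, hp'⟩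
    rw [h3]
    refine (congrArg (fun s => ev χ s p.1) (sndVal_of_mem (X := X) hp' g)).trans ?_
    exact AlgHom.commutes (evHom χ _ p.1 hp) _⟩
  map_one' := Subtype.ext <| funext fun t => map_one _
  map_mul' := fun _ _ => Subtype.ext <| funext fun t => map_mul _ _ _
  map_zero' := Subtype.ext <| funext fun t => map_zero _
  map_add' := fun _ _ => Subtype.ext <| funext fun t => map_add _ _ _
  commutes' := fun r => Subtype.ext <| funext fun t => AlgHom.commutes _ r

/-- The second projection. -/
noncomputable def prodSnd (X : SuperSpace) : SuperSpace.Hom (prodLine X) (superDomain ℝ 0) where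
  base := ⟨Prod.snd, continuous_snd⟩
  pull U := sndPull X U
  pull_par U i s hs t := by
    change sndVal X U t s ∈ _
    by_cases ht : t ∈ U
    · refine (congrArg (· ∈ X.par (slice (Opens.comap ⟨Prod.snd, continuous_snd⟩ U) t) i)
        (sndVal_of_mem (X := X) (U := U) ht s)).mpr ?_
      fin_cases i
      · change algebraMap ℝ _ _ ∈ X.par _ 0
        rw [Algebra.algebraMap_eq_smul_one]
        exact Submodule.smul_mem _ _ (X.supercommutative _).one_mem
      · have : lineVal t ht s = 0 := Grassmann.body_odd (hs ⟨t, ht⟩)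
        rw [this, map_zero]; exact zero_mem _
    · rw [sec_eq_of_empty (fun _ hx => ht hx) (sndVal X U t s) 0]
      exact zero_mem _
  pull_res {U V} h s := Subtype.ext <| funext fun t => by
    change sndVal X U t _ = X.res _ (sndVal X V t s)
    by_cases ht : t ∈ U
    · refine (sndVal_of_mem (X := X) (U := U) ht _).trans ?_
      refine Eq.trans ?_ (congrArg (X.res _) (sndVal_of_mem (X := X) (U := V) (h ht) s)).symm
      exact (AlgHom.commutes (X.res _) _).symm
    · exact sec_eq_of_empty (fun _ hx => ht hx) _ _

/-- The coordinate function on the real line. -/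
noncomputable def coordLine : (superDomain ℝ 0).sec ⊤ :=
  ⟨fun x => algebraMap ℝ (Grassmann 0) x.1, (isSmooth_iff (E := ℝ) (U := ⊤)
    (F := fun x => algebraMap ℝ (Grassmann 0) x) fun _ => rfl).2
    (LinearMap.toContinuousLinearMap (Algebra.linearMap ℝ (Grassmann 0))).contDiff.contDiffOn⟩

theorem evAt_fst (χ : SuperSpace.Hom (superDomain E n) X) {U : Opens X.carrier} (s : X.sec U) (v : E)
    (t : ℝ) (h : χ.base v ∈ U) : evAt χ (Opens.comap (prodFst X).base U) v t h ((prodFst X).pull U s) =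
      ev χ s v := ev_res χ _ s v h

theorem evAt_snd (χ : SuperSpace.Hom (superDomain E n) X) {U : Opens ℝ}
    (g : (superDomain ℝ 0).sec U) (v : E)
    (t : ℝ) (h : t ∈ U) : evAt χ (Opens.comap (prodSnd X).base U) v t h ((prodSnd X).pull U g) =
      algebraMap ℝ _ (lineVal t h g) := by
  refine (congrArg (fun s => ev χ s v) (sndVal_of_mem (X := X) h g)).trans ?_
  exact AlgHom.commutes (evHom χ _ v h) _

theorem evAt_coord (χ : SuperSpace.Hom (superDomain E n) X) (v : E) (t : ℝ) :
    evAt χ (Opens.comap (prodSnd X).base ⊤) v t trivial ((prodSnd X).pull ⊤ coordLine) =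
      algebraMap ℝ _ t := by
  rw [evAt_snd χ coordLine v t trivial]
  exact congrArg _ ((Grassmann.body 0).commutes t)

/-! ### Local structure of the product -/

/-- Every point has an open neighbourhood isomorphic to the superdomain `ℝ^{p|q}`. -/
def LocallySuperdomain (X : SuperSpace) (p q : ℕ) : Prop :=
  ∀ x : X.carrier, ∃ χ : SuperSpace.Hom (superDomain (EuclideanSpace ℝ (Fin p)) q) X,
    χ.IsOpenImmersion ∧ x ∈ Set.range χ.base

/-- The chart of the product induced by a chart. -/
noncomputable def prodChart (χ : SuperSpace.Hom (superDomain E n) X) :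
    SuperSpace.Hom (superDomain (E × ℝ) n) (prodLine X) where
  base := ⟨fun p : E × ℝ => (χ.base p.1, p.2),
    (χ.base.continuous.comp continuous_fst).prodMk continuous_snd⟩
  pull W :=
    { toFun := fun f => ⟨fun p => evAt χ W p.1.1 p.1.2 p.2 f,
        (isSmooth_iff (E := E × ℝ) (F := fun p : E × ℝ => ev χ (f.1 p.2) p.1) fun _ => rfl).2 (f.2 E n χ)⟩
      map_one' := Subtype.ext <| funext fun p => map_one _
      map_mul' := fun _ _ => Subtype.ext <| funext fun p => map_mul _ _ _
      map_zero' := Subtype.ext <| funext fun p => map_zero _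
      map_add' := fun _ _ => Subtype.ext <| funext fun p => map_add _ _ _
      commutes' := fun r => Subtype.ext <| funext fun p => AlgHom.commutes _ r }
  pull_par U i f hf p := ev_par χ (hf p.1.2) p.1.1
  pull_res h f := Subtype.ext <| funext fun p => evAt_res χ h _ _ p.2 f

/-- Smooth families can be constructed in charts. -/
theorem exists_family [FiniteDimensional ℝ E] {χ : SuperSpace.Hom (superDomain E n) X} (hχ : χ.IsOpenImmersion)
    {W : Opens (prodLine X).carrier} (hW : ∀ x t, (x, t) ∈ W → x ∈ Set.range χ.base)
    (F : E × ℝ → Grassmann n) (hF : ContDiffOn ℝ ∞ F {p | (χ.base p.1, p.2) ∈ W}) :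
    ∃ f : (prodLine X).sec W, ∀ (v : E) t (h : (χ.base v, t) ∈ W), evAt χ W v t h f = F (v, t) := by
  have hr : ∀ t, ((slice W t : Opens X.carrier) : Set X.carrier) ⊆ Set.range χ.base :=
    fun t x hx => hW x t hx
  choose f hf using fun t => exists_section hχ (hr t) (fun v => F (v, t))
    (hF.comp (contDiffOn_id.prodMk contDiffOn_const) fun v hv => hv)
  refine ⟨⟨f, fun E' _ _ m κ => ?_⟩, fun v t h => hf t v h⟩
  rintro ⟨v₀, t₀⟩ h₀
  refine (family_contDiffAt hχ κ (W := {p | p ∈ W}) W.isOpen (slice W) (fun t x => Iff.rfl) f ?_ v₀ t₀ h₀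
    (hW _ _ h₀)).contDiffWithinAt
  exact hF.congr fun p hp => hf p.2 p.1 hp

theorem family_ext {χ : SuperSpace.Hom (superDomain E n) X} (hχ : χ.IsOpenImmersion)
    {W : Opens (prodLine X).carrier} (hW : ∀ x t, (x, t) ∈ W → x ∈ Set.range χ.base)
    {f g : (prodLine X).sec W}
    (h : ∀ (v : E) t (h : (χ.base v, t) ∈ W), evAt χ W v t h f = evAt χ W v t h g) : f = g :=
  Subtype.ext <| funext fun t => section_ext hχ (fun x hx => hW x t hx) fun v hv => h v t hv

theorem prodChart_isOpenImmersion [FiniteDimensional ℝ E] {χ : SuperSpace.Hom (superDomain E n) X} (hχ : χ.IsOpenImmersion) :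
    (prodChart χ).IsOpenImmersion := by
  refine ⟨hχ.1.prodMap Topology.IsOpenEmbedding.id, fun W hW => ?_⟩
  have hW' : ∀ x t, (x, t) ∈ W → x ∈ Set.range χ.base := by
    intro x t h
    obtain ⟨p, hp⟩ := hW h
    exact ⟨p.1, congrArg Prod.fst hp⟩
  constructor
  · intro f g hfg
    exact family_ext hχ hW' fun v t h => congrFun (congrArg Subtype.val hfg) ⟨(v, t), h⟩
  · intro F
    obtain ⟨f, hf⟩ := exists_family hχ hW' (ext0 (E := E × ℝ) F.1) (isSmooth_iff_ext0.1 F.2)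
    refine ⟨f, Subtype.ext <| funext fun p => ?_⟩
    exact (hf p.1.1 p.1.2 p.2).trans (ext0_apply (E := E × ℝ) F.1 p)

/-- Linear changes of coordinates. -/
theorem isOpenImmersion_map_comp {E' : Type} [NormedAddCommGroup E'] [NormedSpace ℝ E']
    {χ : SuperSpace.Hom (superDomain E n) X} (hχ : χ.IsOpenImmersion) (a : E' ≃L[ℝ] E) :
    ((superDomain.map n a a.contDiff).comp χ).IsOpenImmersion := by
  refine ⟨hχ.1.comp a.toHomeomorph.isOpenEmbedding, fun U hU => ?_⟩
  have hU' : (U : Set X.carrier) ⊆ Set.range χ.base := fun x hx => by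
    obtain ⟨v, hv⟩ := hU hx
    exact ⟨a v, hv⟩
  refine Function.Bijective.comp (g := (superDomain.map n a a.contDiff).pull (Opens.comap χ.base U)) ?_
    (hχ.2 U hU')
  constructor
  · intro f g hfg
    refine Subtype.ext <| funext fun x => ?_
    have h1 : a (a.symm x.1) = x.1 := a.apply_symm_apply _
    have := congrFun (congrArg Subtype.val hfg) ⟨a.symm x.1, by
      change a (a.symm x.1) ∈ Opens.comap χ.base U
      rw [h1]; exact x.2⟩
    change f.1 ⟨a (a.symm x.1), _⟩ = g.1 ⟨a (a.symm x.1), _⟩ at this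
    simpa only [h1] using this
  · intro f
    refine ⟨⟨fun x => f.1 ⟨a.symm x.1, ?_⟩, ?_⟩, ?_⟩
    · change a (a.symm x.1) ∈ Opens.comap χ.base U
      rw [a.apply_symm_apply]; exact x.2
    · exact IsSmooth.comp (E := E') (E' := E) f.2 a.symm a.symm.contDiff _
    · refine Subtype.ext <| funext fun x => ?_
      change f.1 ⟨a.symm (a x.1), _⟩ = f.1 x
      have h1 : a.symm (a x.1) = x.1 := a.symm_apply_apply _
      simp only [h1]

theorem prodLine_locally {p q : ℕ} (hX : LocallySuperdomain X p q) :
    LocallySuperdomain (prodLine X) (p + 1) q := by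
  rintro ⟨x, t⟩
  obtain ⟨χ, hχ, (y : EuclideanSpace ℝ (Fin p)), rfl⟩ := hX x
  let a : EuclideanSpace ℝ (Fin (p + 1)) ≃L[ℝ] EuclideanSpace ℝ (Fin p) × ℝ :=
    ContinuousLinearEquiv.ofFinrankEq (by simp)
  refine ⟨(superDomain.map q a a.contDiff).comp (prodChart χ),
    isOpenImmersion_map_comp (prodChart_isOpenImmersion hχ) a, a.symm (y, t), ?_⟩
  change (χ.base (a (a.symm (y, t))).1, (a (a.symm (y, t))).2) = _
  rw [a.apply_symm_apply]

theorem id_isOpenImmersion : (SuperSpace.Hom.id X).IsOpenImmersion :=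
  ⟨Topology.IsOpenEmbedding.id, fun _ _ => Function.bijective_id⟩

theorem line_locally : LocallySuperdomain (superDomain ℝ 0) 1 0 := by
  intro x
  let a : EuclideanSpace ℝ (Fin 1) ≃L[ℝ] ℝ := ContinuousLinearEquiv.ofFinrankEq (by simp)
  refine ⟨(superDomain.map 0 a a.contDiff).comp (SuperSpace.Hom.id _),
    isOpenImmersion_map_comp id_isOpenImmersion a, a.symm x, a.apply_symm_apply x⟩

end Product

section Universal

set_option linter.unusedVariables false

attribute [local instance] Grassmann.normedRing Grassmann.normedAlgebra

variable {X T : SuperSpace} {E : Type} [NormedAddCommGroup E] [NormedSpace ℝ E] {n : ℕ}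

/-- The underlying real function of a morphism to the line. -/
noncomputable def tval (κ : SuperSpace.Hom (superDomain E n) (superDomain ℝ 0)) (v : E) : ℝ := κ.base v

theorem coordLine_body (κ : SuperSpace.Hom (superDomain E n) (superDomain ℝ 0)) (v : E) :
    Grassmann.body n (ev κ coordLine v) = tval κ v := by
  refine (body_ev (E := ℝ) id_isOpenImmersion κ coordLine v (tval κ v) rfl trivial).trans ?_
  refine (congrArg (Grassmann.body 0) (ev_apply (E := ℝ) (SuperSpace.Hom.id (superDomain ℝ 0)) coordLine
    (tval κ v) trivial)).trans ?_
  exact (Grassmann.body 0).commutes _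

theorem coordLine_even : coordLine ∈ (superDomain ℝ 0).par ⊤ 0 := by
  intro x
  change algebraMap ℝ (Grassmann 0) _ ∈ _
  rw [Algebra.algebraMap_eq_smul_one]
  exact Submodule.smul_mem _ _ (Grassmann.isSupercommutative 0).one_mem

/-- The nilpotent part of the time coordinate. -/
noncomputable def nil (κ : SuperSpace.Hom (superDomain E n) (superDomain ℝ 0)) (v : E) : Grassmann n :=
  ev κ coordLine v - algebraMap ℝ _ (tval κ v)

theorem nil_pow (κ : SuperSpace.Hom (superDomain E n) (superDomain ℝ 0)) (v : E) :
    nil κ v ^ (n + 2) = 0 := by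
  refine Grassmann.nilpotent ?_
  rw [nil, map_sub, coordLine_body, AlgHom.commutes]
  exact sub_self _

theorem nil_even (κ : SuperSpace.Hom (superDomain E n) (superDomain ℝ 0)) (v : E) :
    nil κ v ∈ Grassmann.par n 0 := by
  refine sub_mem (ev_par κ coordLine_even v) ?_
  rw [Algebra.algebraMap_eq_smul_one]
  exact Submodule.smul_mem _ _ (Grassmann.isSupercommutative n).one_mem

theorem le_comap_top (W : Opens (prodLine X).carrier) : W ≤ Opens.comap (prodSnd X).base ⊤ :=
  fun _ _ => trivial

variable (X) in
/-- The time coordinate centred at `t₀`. -/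
noncomputable def tShift (W : Opens (prodLine X).carrier) (t₀ : ℝ) : (prodLine X).sec W :=
  (prodLine X).res (le_comap_top W)
    ((prodSnd X).pull ⊤ coordLine) - algebraMap ℝ _ t₀

theorem evAt_tShift (χ : SuperSpace.Hom (superDomain E n) X) (W : Opens (prodLine X).carrier) (v : E)
    (t : ℝ) (h : (χ.base v, t) ∈ W) (t₀ : ℝ) :
    evAt χ W v t h (tShift X W t₀) = algebraMap ℝ _ (t - t₀) := by
  rw [tShift, map_sub, AlgHom.commutes, evAt_res, evAt_coord, map_sub]

theorem ev_tShift (κ : SuperSpace.Hom (superDomain E n) (prodLine X)) (W : Opens (prodLine X).carrier)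
    (v : E) (h : κ.base v ∈ W) (t₀ : ℝ) :
    ev κ (tShift X W t₀) v = ev (κ.comp (prodSnd X)) coordLine v - algebraMap ℝ _ t₀ := by
  rw [tShift, ← evHom_apply κ v h, map_sub, AlgHom.commutes, evHom_apply, ev_res κ _ _ _ h]
  rfl

/-- Local Taylor expansion of smooth families in time. -/
theorem expansion {p q : ℕ} (hX : LocallySuperdomain X p q) {W : Opens (prodLine X).carrier}
    (f : (prodLine X).sec W) (z : (prodLine X).carrier) (hz : z ∈ W) (N : ℕ) :
    ∃ (C : Opens X.carrier) (B : Opens (prodLine X).carrier) (hBW : B ≤ W)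
      (hBC : B ≤ Opens.comap (prodFst X).base C), z ∈ B ∧
      ∃ (c : ℕ → X.sec C) (r : (prodLine X).sec B), (prodLine X).res hBW f =
        ∑ k ∈ Finset.range N, tShift X B z.2 ^ k * (prodLine X).res hBC ((prodFst X).pull C (c k)) +
          tShift X B z.2 ^ N * r := by
  obtain ⟨x, t₀⟩ := z
  obtain ⟨χ, hχ, (y : EuclideanSpace ℝ (Fin p)), rfl⟩ := hX x
  obtain ⟨G, hGs, hG⟩ := exists_cutoff (isOpen_plot χ W) (f.2 _ q χ) (x := (y, t₀)) hz
  obtain ⟨c, r, hc, hr, hcr⟩ := hadamard_taylor t₀ N G hGs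
  obtain ⟨M, hM, hMo, hyM⟩ := mem_nhds_iff.1 (Filter.inter_mem hG ((isOpen_plot χ W).mem_nhds hz))
  have hχ' := prodChart_isOpenImmersion hχ
  have hBr : ∀ x t, (x, t) ∈ imageOpen hχ' hMo → x ∈ Set.range χ.base := by
    rintro x t ⟨w, _, hw⟩
    exact ⟨w.1, congrArg Prod.fst hw⟩
  have hBM : ∀ (v : EuclideanSpace ℝ (Fin p)) (t : ℝ), (χ.base v, t) ∈ imageOpen hχ' hMo → (v, t) ∈ M :=
    fun v t h => (base_mem_imageOpen hχ' hMo (v, t)).1 h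
  choose cs hcs using fun k => exists_section hχ (imageOpen_range hχ isOpen_univ) (c k) (hc k).contDiffOn
  obtain ⟨rs, hrs⟩ := exists_family hχ hBr r hr.contDiffOn
  have hBW : imageOpen hχ' hMo ≤ W := by
    rintro _ ⟨w, hw, rfl⟩
    exact (hM hw).2
  have hBC : imageOpen hχ' hMo ≤ Opens.comap (prodFst X).base (imageOpen hχ isOpen_univ) := by
    rintro _ ⟨w, hw, rfl⟩
    exact ⟨w.1, trivial, rfl⟩
  refine ⟨imageOpen hχ isOpen_univ, imageOpen hχ' hMo, hBW, hBC, ⟨(y, t₀), hyM, rfl⟩, cs, rs, ?_⟩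
  refine family_ext hχ hBr fun v t h => ?_
  have hvC : χ.base v ∈ imageOpen hχ isOpen_univ := ⟨v, trivial, rfl⟩
  rw [evAt_res, evAt_apply, map_add, map_sum, map_mul, map_pow, evAt_tShift, hrs]
  have e1 : G (v, t) = ev χ (f.1 t) v := (hM (hBM v t h)).1
  rw [← e1, hcr, ← map_pow, ← Algebra.smul_def]
  congr 1
  refine Finset.sum_congr rfl fun k _ => ?_
  rw [map_mul, map_pow, evAt_tShift, evAt_res, evAt_fst χ (cs k) v t hvC, hcs k v hvC, ← map_pow,
    ← Algebra.smul_def]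

/-- A morphism to the product is determined by its components. -/
theorem ev_prod_determined {p q : ℕ} (hX : LocallySuperdomain X p q)
    {κ₁ κ₂ : SuperSpace.Hom (superDomain E n) (prodLine X)}
    (h1 : κ₁.comp (prodFst X) = κ₂.comp (prodFst X)) (v : E) (hb : κ₁.base v = κ₂.base v)
    (h2 : ev (κ₁.comp (prodSnd X)) coordLine v = ev (κ₂.comp (prodSnd X)) coordLine v)
    {W : Opens (prodLine X).carrier} (f : (prodLine X).sec W) (hv : κ₁.base v ∈ W) :
    ev κ₁ f v = ev κ₂ f v := by
  obtain ⟨C, B, hBW, hBC, hzB, c, r, he⟩ := expansion hX f (κ₁.base v) hv (n + 2)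
  have key : ∀ κ : SuperSpace.Hom (superDomain E n) (prodLine X), κ.base v = κ₁.base v →
      ev κ f v = ∑ k ∈ Finset.range (n + 2), nil (κ.comp (prodSnd X)) v ^ k *
        ev (κ.comp (prodFst X)) (c k) v := by
    intro κ hκ
    have hκB : κ.base v ∈ B := hκ ▸ hzB
    have ht : evHom κ B v hκB (tShift X B (κ₁.base v).2) = nil (κ.comp (prodSnd X)) v := by
      rw [evHom_apply, ev_tShift κ B v hκB, ← hκ]; rfl
    rw [← ev_res κ hBW f v hκB, he, ← evHom_apply κ v hκB, map_add, map_mul, map_pow, ht, nil_pow, zero_mul,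
      add_zero, map_sum]
    refine Finset.sum_congr rfl fun k _ => ?_
    rw [map_mul, map_pow, ht, evHom_apply, ev_res κ _ _ _ hκB]
    rfl
  rw [key κ₁ rfl, key κ₂ hb.symm, h1]
  have : nil (κ₁.comp (prodSnd X)) v = nil (κ₂.comp (prodSnd X)) v := by
    unfold nil
    rw [h2]
    exact congrArg (fun z : ℝ => _ - algebraMap ℝ (Grassmann n) z) (congrArg Prod.snd hb)
  rw [this]

/-- A morphism to the line is determined by its coordinate. -/
theorem ev_line_determined
    {κ₁ κ₂ : SuperSpace.Hom (superDomain E n) (superDomain ℝ 0)} (v : E)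
    (h2 : ev κ₁ coordLine v = ev κ₂ coordLine v)
    {U : Opens (superDomain ℝ 0).carrier} (g : (superDomain ℝ 0).sec U) (hv : κ₁.base v ∈ U) :
    ev κ₁ g v = ev κ₂ g v := by
  have hb : tval κ₁ v = tval κ₂ v := by rw [← coordLine_body, ← coordLine_body, h2]
  set t₀ : ℝ := tval κ₁ v with ht₀
  obtain ⟨G, hGs, hG⟩ := exists_cutoff (E := ℝ) (W := {t | t ∈ U}) U.isOpen
    (isSmooth_iff_ext0.1 g.2) (x := t₀) hv
  obtain ⟨c, r, hc, hr, hcr⟩ := hadamard_taylor (E := ℝ) t₀ (n + 2) (fun p => G p.2)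
    (hGs.comp contDiff_snd)
  obtain ⟨M, hM, hMo, hyM⟩ := mem_nhds_iff.1 (Filter.inter_mem hG (U.isOpen.mem_nhds hv))
  let B : Opens (superDomain ℝ 0).carrier := ⟨M, hMo⟩
  have hBU : B ≤ U := fun t ht => (hM ht).2
  let tt : (superDomain ℝ 0).sec B := (superDomain ℝ 0).res (le_top : B ≤ ⊤) coordLine - algebraMap ℝ _ t₀
  let rr : (superDomain ℝ 0).sec B := ⟨fun x => r (0, x.1), (isSmooth_iff (E := ℝ) (U := B)
    (F := fun t => r (0, t)) fun _ => rfl).2 (hr.comp (contDiff_const.prodMk contDiff_id)).contDiffOn⟩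
  have he : (superDomain ℝ 0).res hBU g = ∑ k ∈ Finset.range (n + 2),
      algebraMap ℝ _ (Grassmann.body 0 (c k 0)) * tt ^ k + tt ^ (n + 2) * rr := by
    have hev : ∀ s s' : (superDomain ℝ 0).sec B, (∀ (t : ℝ) (ht : t ∈ M), ev (SuperSpace.Hom.id _) s t =
      ev (SuperSpace.Hom.id _) s' t) → s = s' := fun s s' h =>
        section_ext id_isOpenImmersion (fun x _ => ⟨x, rfl⟩) h
    refine hev _ _ fun t ht => ?_
    have htB : (SuperSpace.Hom.id (superDomain ℝ 0)).base t ∈ B := ht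
    have htt : evHom (SuperSpace.Hom.id (superDomain ℝ 0)) B t htB tt = algebraMap ℝ _ (t - t₀) := by
      rw [map_sub, AlgHom.commutes, map_sub, evHom_apply, ev_res _ _ _ _ htB]
      refine congrArg (· - algebraMap ℝ (Grassmann 0) t₀) (ev_apply (E := ℝ)
        (SuperSpace.Hom.id (superDomain ℝ 0)) coordLine t trivial)
    rw [ev_res _ _ _ _ htB, ← evHom_apply _ t htB, map_add, map_mul, map_pow, htt, map_sum]
    have e1 : ev (SuperSpace.Hom.id _) g t = G t := ((hM ht).1).symm
    have e2 : evHom (SuperSpace.Hom.id (superDomain ℝ 0)) B t htB rr = r (0, t) := by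
      rw [evHom_apply, ev_apply _ _ t htB]; rfl
    rw [e1, e2, hcr 0 t, ← map_pow, ← Algebra.smul_def]
    congr 1
    refine Finset.sum_congr rfl fun k _ => ?_
    rw [map_mul, map_pow, htt, AlgHom.commutes, ← Grassmann.eq_body_zero, Algebra.smul_def, map_pow]
    rw [← map_pow]; exact Algebra.commutes _ _
  have key : ∀ κ : SuperSpace.Hom (superDomain E n) (superDomain ℝ 0), tval κ v = t₀ →
      ev κ g v = ∑ k ∈ Finset.range (n + 2), algebraMap ℝ _ (Grassmann.body 0 (c k 0)) * nil κ v ^ k := by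
    intro κ hκ
    have hκB : κ.base v ∈ B := by
      change tval κ v ∈ M
      rw [hκ]; exact hyM
    have ht : evHom κ B v hκB tt = nil κ v := by
      rw [map_sub, AlgHom.commutes, evHom_apply, ev_res κ _ _ _ hκB, ← hκ]; rfl
    rw [← ev_res κ hBU g v hκB, he, ← evHom_apply κ v hκB, map_add, map_mul, map_pow, ht, nil_pow, zero_mul,
      add_zero, map_sum]
    refine Finset.sum_congr rfl fun k _ => ?_
    rw [map_mul, map_pow, ht, AlgHom.commutes]
  rw [key κ₁ rfl, key κ₂ hb.symm]
  have : nil κ₁ v = nil κ₂ v := by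
    unfold nil
    rw [h2, ← hb]
  rw [this]

/-- Sections of a supermanifold are determined by their pull-backs to superdomains. -/
theorem section_ext_of_plots {p q : ℕ} (hT : LocallySuperdomain T p q) {U : Opens T.carrier} {s t : T.sec U}
    (h : ∀ (χ : SuperSpace.Hom (superDomain (EuclideanSpace ℝ (Fin p)) q) T)
      (v : EuclideanSpace ℝ (Fin p)), χ.base v ∈ U → ev χ s v = ev χ t v) : s = t := by
  choose χ hχ hr using hT
  refine T.eq_of_res (fun x : T.carrier => U ⊓ imageOpen (hχ x) isOpen_univ) U (fun x => inf_le_left) ?_ _ _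
    fun x => ?_
  · intro x hx
    obtain ⟨v, hv⟩ := hr x
    exact Opens.mem_iSup.2 ⟨x, hx, v, trivial, hv⟩
  · refine section_ext (hχ x) (fun y (hy : y ∈ U ⊓ imageOpen (hχ x) isOpen_univ) =>
      imageOpen_range (hχ x) isOpen_univ hy.2) fun (v : EuclideanSpace ℝ (Fin p)) hv => ?_
    rw [ev_res _ _ _ _ hv, ev_res _ _ _ _ hv]
    exact h (χ x) v hv.1

end Universal

section Lift

set_option linter.unusedVariables false

attribute [local instance] Grassmann.normedRing Grassmann.normedAlgebra

variable {X T : SuperSpace} {E : Type} [NormedAddCommGroup E] [NormedSpace ℝ E] {n : ℕ}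

theorem ev_coord_smooth (σ : SuperSpace.Hom (superDomain E n) (superDomain ℝ 0)) :
    ContDiff ℝ ∞ (ev σ coordLine) :=
  contDiffOn_univ.1 ((ev_smooth σ coordLine).mono fun _ _ => trivial)

theorem tval_smooth (σ : SuperSpace.Hom (superDomain E n) (superDomain ℝ 0)) : ContDiff ℝ ∞ (tval σ) := by
  have h : tval σ = fun v => Grassmann.body n (ev σ coordLine v) := funext fun v => (coordLine_body σ v).symm
  rw [h]
  exact (LinearMap.toContinuousLinearMap (Grassmann.body n).toLinearMap).contDiff.comp (ev_coord_smooth σ)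

theorem nil_smooth (σ : SuperSpace.Hom (superDomain E n) (superDomain ℝ 0)) : ContDiff ℝ ∞ (nil σ) :=
  (ev_coord_smooth σ).sub
    ((LinearMap.toContinuousLinearMap (Algebra.linearMap ℝ (Grassmann n))).contDiff.comp (tval_smooth σ))

/-- The pull-back of a family along a pair of morphisms from a superdomain. -/
noncomputable def pairEv (α : SuperSpace.Hom (superDomain E n) X)
    (σ : SuperSpace.Hom (superDomain E n) (superDomain ℝ 0)) {W : Opens (prodLine X).carrier}
    (f : (prodLine X).sec W) (v : E) : Grassmann n :=
  jetEval (n + 2) (fun t => ev α (f.1 t) v) (tval σ v) (nil σ v)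

variable (α : SuperSpace.Hom (superDomain E n) X)
    (σ : SuperSpace.Hom (superDomain E n) (superDomain ℝ 0)) {W : Opens (prodLine X).carrier}

theorem eventually_mem (v : E) (t : ℝ) (h : (α.base v, t) ∈ W) : ∀ᶠ s in nhds t, (α.base v, s) ∈ W :=
  (by fun_prop : Continuous fun s : ℝ => (v, s)).continuousAt.preimage_mem_nhds
    ((isOpen_plot α W).mem_nhds (x := (v, t)) h)

theorem slice_contDiffAt (f : (prodLine X).sec W) (v : E) (t : ℝ) (h : (α.base v, t) ∈ W) :
    ContDiffAt ℝ ∞ (fun s => ev α (f.1 s) v) t := by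
  have h1 := (f.2 E n α).contDiffAt ((isOpen_plot α W).mem_nhds (x := (v, t)) h)
  exact ContDiffAt.comp (f := fun s : ℝ => (v, s)) t h1 (contDiffAt_const.prodMk contDiffAt_id)

theorem pairEv_congr {W' : Opens (prodLine X).carrier} (f : (prodLine X).sec W) (f' : (prodLine X).sec W')
    (v : E) (h : ∀ᶠ s in nhds (tval σ v), ev α (f.1 s) v = ev α (f'.1 s) v) :
    pairEv α σ f v = pairEv α σ f' v := jetEval_congr h

theorem pairEv_const (a : Grassmann n) (f : (prodLine X).sec W)
    (v : E) (h : ∀ᶠ s in nhds (tval σ v), ev α (f.1 s) v = a) : pairEv α σ f v = a :=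
  (jetEval_congr h).trans (jetEval_const (by omega) a _ _)

/-- The value of the pull-back at a point is an algebra homomorphism. -/
noncomputable def pairHom (W : Opens (prodLine X).carrier) (v : E) (h : (α.base v, tval σ v) ∈ W) :
    (prodLine X).sec W →ₐ[ℝ] Grassmann n where
  toFun f := pairEv α σ f v
  map_one' := pairEv_const α σ 1 _ v <| (eventually_mem α v _ h).mono fun s hs => map_one (evAt α W v s hs)
  map_zero' := pairEv_const α σ 0 _ v <| (eventually_mem α v _ h).mono fun s hs => map_zero (evAt α W v s hs)
  map_mul' f g := by
    refine (jetEval_congr (δ := (fun t => ev α (f.1 t) v) * (fun t => ev α (g.1 t) v))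
      ((eventually_mem α v _ h).mono fun s hs => map_mul (evAt α W v s hs) f g)).trans ?_
    exact jetEval_mul (slice_contDiffAt α f v _ h) (slice_contDiffAt α g v _ h)
      (fun a => (Grassmann.isSupercommutative n).even_comm (nil_even σ v) a) (nil_pow σ v)
  map_add' f g := by
    refine (jetEval_congr (δ := (fun t => ev α (f.1 t) v) + (fun t => ev α (g.1 t) v))
      ((eventually_mem α v _ h).mono fun s hs => map_add (evAt α W v s hs) f g)).trans ?_
    exact jetEval_add (slice_contDiffAt α f v _ h) (slice_contDiffAt α g v _ h)
  commutes' r := pairEv_const α σ _ _ v <| (eventually_mem α v _ h).mono fun s hs =>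
    AlgHom.commutes (evAt α W v s hs) r

theorem pairHom_apply (v : E) (h : (α.base v, tval σ v) ∈ W) (f : (prodLine X).sec W) :
    pairHom α σ W v h f = pairEv α σ f v := rfl

theorem pairEv_res {U : Opens (prodLine X).carrier} (hUW : U ≤ W) (f : (prodLine X).sec W) (v : E)
    (h : (α.base v, tval σ v) ∈ U) : pairEv α σ ((prodLine X).res hUW f) v = pairEv α σ f v :=
  pairEv_congr α σ _ _ v <| (eventually_mem α v _ h).mono fun s hs => evAt_res α hUW v s hs f

theorem pairEv_fst {U : Opens X.carrier} (s : X.sec U) (v : E) (h : α.base v ∈ U) :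
    pairEv α σ ((prodFst X).pull U s) v = ev α s v :=
  pairEv_const α σ _ _ v <| Filter.Eventually.of_forall fun t => evAt_fst α s v t h

theorem pairEv_coord (v : E) : pairEv α σ ((prodSnd X).pull ⊤ coordLine) v = ev σ coordLine v := by
  refine (jetEval_congr (Filter.Eventually.of_forall fun t => evAt_coord α v t)).trans ?_
  refine (jetEval_id (by omega) _ _).trans ?_
  unfold nil
  abel

theorem pairEv_tShift (v : E) (h : (α.base v, tval σ v) ∈ W) (t₀ : ℝ) :
    pairHom α σ W v h (tShift X W t₀) = ev σ coordLine v - algebraMap ℝ _ t₀ := by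
  rw [tShift, map_sub, AlgHom.commutes, pairHom_apply, pairEv_res α σ _ _ v h, pairEv_coord]

theorem pairEv_smooth (f : (prodLine X).sec W) :
    ContDiffOn ℝ ∞ (pairEv α σ f) {v | (α.base v, tval σ v) ∈ W} :=
  jetEval_contDiffOn (G := fun p => ev α (f.1 p.2) p.1) (isOpen_plot α W) (f.2 E n α) (n + 2)
    (tval_smooth σ).contDiffOn (nil_smooth σ).contDiffOn fun v hv => hv

theorem Grassmann.smul_mul_mem {i : ZMod 2} {a b : Grassmann n} (ha : a ∈ Grassmann.par n i)
    (hb : b ∈ Grassmann.par n 0) (c : ℝ) : (c • a) * b ∈ Grassmann.par n i := by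
  have h1 : c • a ∈ Grassmann.par n i := Submodule.smul_mem (Grassmann.par n i) c ha
  have h3 : (c • a) * b ∈ Grassmann.par n (i + 0) := (Grassmann.isSupercommutative n).mul_mem h1 hb
  have h4 : i + 0 = i := add_zero i
  exact h4 ▸ h3

theorem pairEv_par {i : ZMod 2} {f : (prodLine X).sec W} (hf : f ∈ (prodLine X).par W i) (v : E) :
    pairEv α σ f v ∈ Grassmann.par n i := by
  have key : ∀ k : ℕ, ∀ t, iteratedDeriv k (fun t => ev α (f.1 t) v) t ∈ Grassmann.par n i := by
    intro k
    induction k with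
    | zero => intro t; rw [iteratedDeriv_zero]; exact ev_par α (hf t) v
    | succ k ih =>
      intro t
      rw [iteratedDeriv_succ]
      have hcl : IsClosed ((Grassmann.par n i : Submodule ℝ (Grassmann n)) : Set (Grassmann n)) :=
        Submodule.closed_of_finiteDimensional _
      have h1 := range_deriv_subset_closure_span_image (𝕜 := ℝ)
        (iteratedDeriv k (fun t => ev α (f.1 t) v)) (t := Set.univ) dense_univ ⟨t, rfl⟩
      refine closure_minimal ?_ hcl h1
      rw [SetLike.coe_subset_coe, Submodule.span_le]
      rintro _ ⟨s, _, rfl⟩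
      exact ih s
  unfold pairEv jetEval
  refine sum_mem fun k _ => ?_
  have hν : ∀ k : ℕ, nil σ v ^ k ∈ Grassmann.par n 0 := by
    intro k
    induction k with
    | zero => rw [pow_zero]; exact (Grassmann.isSupercommutative n).one_mem
    | succ k ih =>
      rw [pow_succ, ← one_smul ℝ (nil σ v ^ k)]
      exact Grassmann.smul_mul_mem ih (nil_even σ v) 1
  exact Grassmann.smul_mul_mem (key k (tval σ v)) (hν k) _

variable (φ : SuperSpace.Hom T X) (τ : SuperSpace.Hom T (superDomain ℝ 0))

/-- The map to the product of the underlying spaces. -/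
noncomputable def pairBase : C(T.carrier, (prodLine X).carrier) :=
  ⟨fun x => (φ.base x, τ.base x), φ.base.continuous.prodMk τ.base.continuous⟩

theorem pair_natural {p q : ℕ} (hX : LocallySuperdomain X p q) [FiniteDimensional ℝ E]
    {χ : SuperSpace.Hom (superDomain E n) T} (hχ : χ.IsOpenImmersion) {U : Opens T.carrier}
    (hU : (U : Set T.carrier) ⊆ Set.range χ.base) (hUW : U ≤ Opens.comap (pairBase φ τ) W)
    (f : (prodLine X).sec W) (s : T.sec U)
    (hs : ∀ v : E, χ.base v ∈ U → ev χ s v = pairEv (χ.comp φ) (χ.comp τ) f v)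
    {E' : Type} [NormedAddCommGroup E'] [NormedSpace ℝ E'] {m : ℕ}
    (κ : SuperSpace.Hom (superDomain E' m) T) (v₀ : E') (hv₀ : κ.base v₀ ∈ U) :
    ev κ s v₀ = pairEv (κ.comp φ) (κ.comp τ) f v₀ := by
  set t₀ : ℝ := tval (κ.comp τ) v₀ with ht₀
  obtain ⟨C, B, hBW, hBC, hzB, c, r, he⟩ := expansion hX f (pairBase φ τ (κ.base v₀)) (hUW hv₀) (m + 2)
  change _ = ∑ k ∈ Finset.range (m + 2), tShift X B t₀ ^ k * _ + tShift X B t₀ ^ (m + 2) * r at he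
  have hOU : U ⊓ Opens.comap (pairBase φ τ) B ≤ U := inf_le_left
  have hOr : ((U ⊓ Opens.comap (pairBase φ τ) B : Opens T.carrier) : Set T.carrier) ⊆ Set.range χ.base :=
    fun x hx => hU hx.1
  have hOC : U ⊓ Opens.comap (pairBase φ τ) B ≤ Opens.comap φ.base C := fun x hx => hBC hx.2
  have hOt : U ⊓ Opens.comap (pairBase φ τ) B ≤ Opens.comap τ.base ⊤ := fun x hx => trivial
  set O : Opens T.carrier := U ⊓ Opens.comap (pairBase φ τ) B with hO
  have hpair : ∀ {E' : Type} [NormedAddCommGroup E'] [NormedSpace ℝ E'] {m' : ℕ}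
      (κ : SuperSpace.Hom (superDomain E' m') T) (v : E') (hv : κ.base v ∈ O),
      pairEv (κ.comp φ) (κ.comp τ) f v = ∑ k ∈ Finset.range (m + 2),
        (ev (κ.comp τ) coordLine v - algebraMap ℝ _ t₀) ^ k * ev (κ.comp φ) (c k) v +
        (ev (κ.comp τ) coordLine v - algebraMap ℝ _ t₀) ^ (m + 2) * pairEv (κ.comp φ) (κ.comp τ) r v := by
    intro E' _ _ m' κ v hv
    have hvB : ((κ.comp φ).base v, tval (κ.comp τ) v) ∈ B := hv.2
    rw [← pairEv_res (κ.comp φ) (κ.comp τ) hBW f v hvB, he, ← pairHom_apply _ _ v hvB, map_add, map_mul,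
      map_pow, pairEv_tShift, map_sum, pairHom_apply]
    congr 1
    refine Finset.sum_congr rfl fun k _ => ?_
    rw [map_mul, map_pow, pairEv_tShift, pairHom_apply, pairEv_res _ _ _ _ _ hvB,
      pairEv_fst (κ.comp φ) (κ.comp τ) (c k) v (hOC hv)]
  obtain ⟨ρ, hρ⟩ := exists_section hχ hOr (pairEv (χ.comp φ) (χ.comp τ) r)
    ((pairEv_smooth (χ.comp φ) (χ.comp τ) r).mono fun v hv => hv.2)
  set ψ : T.sec O := T.res hOt (τ.pull ⊤ coordLine) - algebraMap ℝ _ t₀ with hψ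
  have hψe : ∀ {E' : Type} [NormedAddCommGroup E'] [NormedSpace ℝ E'] {m' : ℕ}
      (κ : SuperSpace.Hom (superDomain E' m') T) (v : E') (hv : κ.base v ∈ O),
      evHom κ O v hv ψ = ev (κ.comp τ) coordLine v - algebraMap ℝ _ t₀ := by
    intro E' _ _ m' κ v hv
    rw [hψ, map_sub, AlgHom.commutes, evHom_apply, ev_res κ _ _ _ hv]
    rfl
  have hsum : ∀ {E' : Type} [NormedAddCommGroup E'] [NormedSpace ℝ E'] {m' : ℕ}
      (κ : SuperSpace.Hom (superDomain E' m') T) (v : E') (hv : κ.base v ∈ O),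
      ev κ (∑ k ∈ Finset.range (m + 2), ψ ^ k * T.res hOC (φ.pull C (c k)) + ψ ^ (m + 2) * ρ) v =
        ∑ k ∈ Finset.range (m + 2),
        (ev (κ.comp τ) coordLine v - algebraMap ℝ _ t₀) ^ k * ev (κ.comp φ) (c k) v +
        (ev (κ.comp τ) coordLine v - algebraMap ℝ _ t₀) ^ (m + 2) * ev κ ρ v := by
    intro E' _ _ m' κ v hv
    rw [← evHom_apply κ v hv, map_add, map_mul, map_pow, hψe, map_sum, evHom_apply]
    congr 1
    refine Finset.sum_congr rfl fun k _ => ?_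
    rw [map_mul, map_pow, hψe, evHom_apply, ev_res κ _ _ _ hv]
    rfl
  have hs' : T.res hOU s = ∑ k ∈ Finset.range (m + 2), ψ ^ k * T.res hOC (φ.pull C (c k)) + ψ ^ (m + 2) * ρ := by
    refine section_ext hχ hOr fun (v : E) hv => ?_
    rw [hsum χ v hv, ev_res χ _ _ _ hv, hs v hv.1, hpair χ v hv, hρ v hv]
  have hv₀O : κ.base v₀ ∈ O := ⟨hv₀, hzB⟩
  have hnil : (ev (κ.comp τ) coordLine v₀ - algebraMap ℝ _ t₀) ^ (m + 2) = 0 := nil_pow (κ.comp τ) v₀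
  rw [← ev_res κ hOU s v₀ hv₀O, hs', hsum κ v₀ hv₀O, hpair κ v₀ hv₀O, hnil, zero_mul, zero_mul]

variable {p q p' q' : ℕ}

theorem exists_pair (hX : LocallySuperdomain X p q) (hT : LocallySuperdomain T p' q')
    (f : (prodLine X).sec W) : ∃ s : T.sec (Opens.comap (pairBase φ τ) W),
    ∀ (E : Type) [NormedAddCommGroup E] [NormedSpace ℝ E] (n : ℕ)
      (κ : SuperSpace.Hom (superDomain E n) T) (v : E), (pairBase φ τ) (κ.base v) ∈ W →
      ev κ s v = pairEv (κ.comp φ) (κ.comp τ) f v := by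
  choose χ hχ hr using hT
  have hr' : ∀ x, ((Opens.comap (pairBase φ τ) W ⊓ imageOpen (hχ x) isOpen_univ : Opens T.carrier) :
      Set T.carrier) ⊆ Set.range (χ x).base := fun x y hy => imageOpen_range (hχ x) isOpen_univ hy.2
  choose s hs using fun x => exists_section (hχ x) (hr' x)
    (pairEv ((χ x).comp φ) ((χ x).comp τ) f) ((pairEv_smooth _ _ f).mono fun v hv => hv.1)
  have hnat : ∀ x, ∀ {E' : Type} [NormedAddCommGroup E'] [NormedSpace ℝ E'] {m : ℕ}
      (κ : SuperSpace.Hom (superDomain E' m) T) (v : E'),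
      κ.base v ∈ Opens.comap (pairBase φ τ) W ⊓ imageOpen (hχ x) isOpen_univ →
        ev κ (s x) v = pairEv (κ.comp φ) (κ.comp τ) f v := fun x _ _ _ _ κ v hv =>
    pair_natural φ τ hX (hχ x) (hr' x) inf_le_left f (s x) (hs x) κ v hv
  have hcov : Opens.comap (pairBase φ τ) W ≤
      ⨆ x, Opens.comap (pairBase φ τ) W ⊓ imageOpen (hχ x) isOpen_univ := by
    intro x hx
    obtain ⟨v, hv⟩ := hr x
    exact Opens.mem_iSup.2 ⟨x, hx, v, trivial, hv⟩
  obtain ⟨g, hg⟩ := T.exists_glue _ (Opens.comap (pairBase φ τ) W) (fun x => inf_le_left) hcov s (by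
    intro x y
    refine section_ext (hχ x) (fun z hz => hr' x (And.left hz)) fun (v : EuclideanSpace ℝ (Fin p')) hv => ?_
    rw [ev_res _ _ _ _ hv, ev_res _ _ _ _ hv, hnat x _ v hv.1, hnat y _ v hv.2])
  refine ⟨g, fun E _ _ n κ v hv => ?_⟩
  obtain ⟨x, hx⟩ := Opens.mem_iSup.1 (hcov hv)
  rw [← hnat x κ v hx, ← hg x, ev_res κ _ _ _ hx]

theorem section_par_of_plots (hT : LocallySuperdomain T p' q') {U : Opens T.carrier} {s : T.sec U} {i : ZMod 2}
    (h : ∀ (χ : SuperSpace.Hom (superDomain (EuclideanSpace ℝ (Fin p')) q') T)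
      (v : EuclideanSpace ℝ (Fin p')), χ.base v ∈ U → ev χ s v ∈ Grassmann.par q' i) :
    s ∈ T.par U i := by
  obtain ⟨L, hL, hL'⟩ := (T.supercommutative U).exists_proj
  have hc := (Grassmann.isSupercommutative q').isCompl
  have hcase : s = L i s := by
    refine section_ext_of_plots hT fun χ v hv => ?_
    have ha : ev χ (L 0 s) v + ev χ (L 1 s) v = ev χ s v := by
      conv_rhs => rw [← hL' s]
      exact (map_add (evHom χ U v hv) _ _).symm
    have h0 := ev_par χ (hL 0 s) v
    have h1 := ev_par χ (hL 1 s) v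
    have hs := h χ v hv
    fin_cases i
    · have h2 : ev χ (L 1 s) v ∈ Grassmann.par q' 0 := by
        rw [eq_sub_of_add_eq' ha]; exact sub_mem hs h0
      have := (Submodule.disjoint_def.1 hc.disjoint) _ h2 h1
      rw [this, add_zero] at ha
      exact ha.symm
    · have h2 : ev χ (L 0 s) v ∈ Grassmann.par q' 1 := by
        rw [eq_sub_of_add_eq ha]; exact sub_mem hs h1
      have := (Submodule.disjoint_def.1 hc.disjoint) _ h0 h2
      rw [this, zero_add] at ha
      exact ha.symm
  rw [hcase]
  exact hL i s

/-- The universal property of the product: existence. -/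
theorem exists_lift (hX : LocallySuperdomain X p q) (hT : LocallySuperdomain T p' q') :
    ∃ m : SuperSpace.Hom T (prodLine X), m.comp (prodFst X) = φ ∧ m.comp (prodSnd X) = τ := by
  choose s hs using fun (W : Opens (prodLine X).carrier) f => exists_pair (W := W) φ τ hX hT f
  have hs' : ∀ W f (κ : SuperSpace.Hom (superDomain (EuclideanSpace ℝ (Fin p')) q') T) v
      (hv : (pairBase φ τ) (κ.base v) ∈ W), ev κ (s W f) v = pairHom (κ.comp φ) (κ.comp τ) W v hv f :=
    fun W f κ v hv => hs W f _ _ κ v hv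
  let m : SuperSpace.Hom T (prodLine X) :=
    { base := pairBase φ τ
      pull := fun W =>
        { toFun := s W
          map_one' := section_ext_of_plots hT fun κ v hv => by
            rw [hs' W _ κ v hv, map_one, ← evHom_apply κ v hv, map_one]
          map_zero' := section_ext_of_plots hT fun κ v hv => by
            rw [hs' W _ κ v hv, map_zero, ← evHom_apply κ v hv, map_zero]
          map_mul' := fun f g => section_ext_of_plots hT fun κ v hv => by
            rw [hs' W _ κ v hv, map_mul, ← evHom_apply κ v hv, map_mul, evHom_apply, evHom_apply,
              hs' W _ κ v hv, hs' W _ κ v hv]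
          map_add' := fun f g => section_ext_of_plots hT fun κ v hv => by
            rw [hs' W _ κ v hv, map_add, ← evHom_apply κ v hv, map_add, evHom_apply, evHom_apply,
              hs' W _ κ v hv, hs' W _ κ v hv]
          commutes' := fun r => section_ext_of_plots hT fun κ v hv => by
            rw [hs' W _ κ v hv, AlgHom.commutes, ← evHom_apply κ v hv, AlgHom.commutes] }
      pull_par := fun W i f hf => section_par_of_plots hT fun κ v hv => by
        change ev κ (s W f) v ∈ _
        rw [hs W f _ _ κ v hv]
        exact pairEv_par _ _ hf v
      pull_res := fun {U V} h f => section_ext_of_plots hT fun κ v hv => by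
        change ev κ (s U _) v = ev κ (T.res _ (s V f)) v
        rw [ev_res κ _ _ _ hv, hs U _ _ _ κ v hv, hs V _ _ _ κ v (h hv)]
        exact pairEv_res _ _ h f v hv }
  refine ⟨m, SuperSpace.Hom.ext' rfl fun U g => ?_, SuperSpace.Hom.ext' rfl fun U g => ?_⟩
  · refine section_ext_of_plots hT fun κ v hv => ?_
    rw [ev_res κ _ _ _ hv]
    refine (hs _ _ _ _ κ v hv).trans ?_
    exact pairEv_fst _ _ g v hv
  · refine section_ext_of_plots hT fun κ v hv => ?_
    rw [ev_res κ _ _ _ hv]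
    refine ev_line_determined (κ₁ := κ.comp (m.comp (prodSnd X))) (κ₂ := κ.comp τ) v ?_ g hv
    refine (hs (Opens.comap (prodSnd X).base ⊤) ((prodSnd X).pull ⊤ coordLine) _ _ κ v
      (show (pairBase φ τ) (κ.base v) ∈ Opens.comap (prodSnd X).base ⊤ from trivial)).trans ?_
    exact pairEv_coord _ _ v

/-- The universal property of the product: uniqueness. -/
theorem lift_unique (hX : LocallySuperdomain X p q) (hT : LocallySuperdomain T p' q')
    {m₁ m₂ : SuperSpace.Hom T (prodLine X)}
    (h1 : m₁.comp (prodFst X) = m₂.comp (prodFst X)) (h2 : m₁.comp (prodSnd X) = m₂.comp (prodSnd X)) :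
    m₁ = m₂ := by
  have hb : m₁.base = m₂.base := by
    refine ContinuousMap.ext fun x => Prod.ext ?_ ?_
    · exact DFunLike.congr_fun (congrArg SuperSpace.Hom.base h1) x
    · exact DFunLike.congr_fun (congrArg SuperSpace.Hom.base h2) x
  refine SuperSpace.Hom.ext' hb fun U f => section_ext_of_plots hT fun κ v hv => ?_
  rw [ev_res κ _ _ _ hv]
  have hv1 : (κ.comp m₁).base v ∈ U := by
    change m₁.base _ ∈ U
    rw [hb]; exact hv
  refine ev_prod_determined (κ₁ := κ.comp m₁) (κ₂ := κ.comp m₂) hX ?_ v ?_ ?_ f hv1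
  · exact congrArg (SuperSpace.Hom.comp κ) h1
  · exact congrArg (fun b : C(T.carrier, (prodLine X).carrier) => b (κ.base v)) hb
  · have h3 : (κ.comp m₁).comp (prodSnd X) = (κ.comp m₂).comp (prodSnd X) :=
      congrArg (SuperSpace.Hom.comp κ) h2
    rw [h3]

end Lift

open CategoryTheory CategoryTheory.Limits

/-- A real supermanifold of finite dimension `p|q`: a superringed space over a Hausdorff, second
countable topological space in which every point has an open neighbourhood isomorphic to the
superdomain `ℝ^{p|q}`. Its stalks are then local rings (in the superdomain a function is invertible
near a point if and only if its value there is nonzero). -/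
structure Supermanifold extends SuperSpace where
  t2 : T2Space carrier
  secondCountable : SecondCountableTopology carrier
  locally_superdomain : ∃ p q : ℕ, ∀ x : carrier,
    ∃ χ : SuperSpace.Hom (superDomain (EuclideanSpace ℝ (Fin p)) q) toSuperSpace,
      χ.IsOpenImmersion ∧ x ∈ Set.range χ.base

/-- The category of supermanifolds. The morphisms are the morphisms of superringed spaces; between
supermanifolds these automatically preserve the values of functions (`body_ev`), that is, they are
local on stalks. -/
instance : Category Supermanifold where
  Hom X Y := SuperSpace.Hom X.toSuperSpace Y.toSuperSpace
  id X := SuperSpace.Hom.id X.toSuperSpace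
  comp f g := SuperSpace.Hom.comp f g
  id_comp _ := rfl
  comp_id _ := rfl
  assoc _ _ _ := rfl

/-- The real line as a supermanifold of dimension `1|0`. -/
noncomputable def realLine : Supermanifold where
  toSuperSpace := superDomain ℝ 0
  t2 := inferInstanceAs (T2Space ℝ)
  secondCountable := inferInstanceAs (SecondCountableTopology ℝ)
  locally_superdomain := ⟨1, 0, line_locally⟩

/-- The action of `(ℝ, ·)` on the real line: `t ↦ l * t`. -/
noncomputable def scaling (l : ℝ) : realLine ⟶ realLine :=
  superDomain.map 0 (fun t : ℝ => l * t) (contDiff_const.mul contDiff_id)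

/-- The product supermanifold of a supermanifold with the real line. -/
noncomputable def timesLine (S : Supermanifold) : Supermanifold where
  toSuperSpace := prodLine S.toSuperSpace
  t2 := by
    have := S.t2
    exact inferInstanceAs (T2Space (S.carrier × ℝ))
  secondCountable := by
    have := S.secondCountable
    exact inferInstanceAs (SecondCountableTopology (S.carrier × ℝ))
  locally_superdomain := by
    obtain ⟨p, q, h⟩ := S.locally_superdomain
    exact ⟨p + 1, q, prodLine_locally h⟩

/-- Every supermanifold has a categorical product with the real line. -/
instance (S : Supermanifold) : HasBinaryProduct S realLine := by
  let c : BinaryFan S realLine := BinaryFan.mk (P := timesLine S) (prodFst S.toSuperSpace : timesLine S ⟶ S)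
    (prodSnd S.toSuperSpace : timesLine S ⟶ realLine)
  obtain ⟨p, q, hS⟩ := S.locally_superdomain
  have hex : ∀ {T : Supermanifold} (f : T ⟶ S) (g : T ⟶ realLine), ∃ m : T ⟶ timesLine S,
      m ≫ c.fst = f ∧ m ≫ c.snd = g := by
    intro T f g
    obtain ⟨p', q', hT⟩ := T.locally_superdomain
    exact exists_lift f g hS hT
  choose m h1 h2 using @hex
  refine HasLimit.mk ⟨c, BinaryFan.isLimitMk (fun s => m s.fst s.snd) (fun s => h1 _ _) (fun s => h2 _ _) ?_⟩
  intro s k hk1 hk2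
  obtain ⟨p', q', hT⟩ := s.pt.locally_superdomain
  exact lift_unique hS hT (hk1.trans (h1 s.fst s.snd).symm) (hk2.trans (h2 s.fst s.snd).symm)

/-- The set `Hom(S × ℝ, M)` of `S`-curves on `M`, that is, the value at `S` of the internal hom of
`ℝ` and `M`. -/
abbrev SCurve (M S : Supermanifold) : Type := S ⨯ realLine ⟶ M

/-- The map on curves induced by a morphism `ψ : P ⟶ S`, namely `γ ↦ γ ∘ (ψ × Id)`. -/
noncomputable def SCurve.induced (M : Supermanifold) {P S : Supermanifold} (ψ : P ⟶ S) :
    SCurve M S → SCurve M P :=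
  fun γ => prod.map ψ (𝟙 realLine) ≫ γ

/-- The action of `(ℝ, ·)` on `S`-curves, `(l, γ) ↦ γ ∘ (Id × g_l)` with `g_l t = l * t`. -/
noncomputable def SCurve.act (M S : Supermanifold) : ℝ × SCurve M S → SCurve M S :=
  fun a => prod.map (𝟙 S) (scaling a.1) ≫ a.2

end SuperGeometry

open CategoryTheory SuperGeometry

/-! ### Scalings of the line -/

namespace SuperGeometry

open CategoryTheory CategoryTheory.Limits

/-! The statement itself is formal. The maps `g_l` satisfy `g_1 = Id` and `g_{lm} = g_m ∘ g_l`, so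
they form an action of `(ℝ, ·)` on the line by endomorphisms. Applying the functor `S × -` and then
precomposing an arrow to `M` transports this action to curves. Naturality in `S` says that changing
the first factor commutes with changing the second: `(Id × g_l) ≫ (ψ × Id)` and `(ψ × Id) ≫ (Id ×
g_l)`, with the identities of the appropriate factors, are both `ψ × g_l`. Nothing is asked of `l`,
so `l = 0`, where `g_l` is not invertible, needs no separate treatment. Only `scaling_one` and
`scaling_mul` look at what a morphism of supermanifolds is; the rest is bifunctoriality of the
binary product. That the category has no product with the line other than up to isomorphism is
harmless: no explicit model of `S ⨯ realLine` enters the argument.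

The substance lies in the existence of that product, on which the notion of curve rests. The model
is `prodLine`: a function on an open part of `X × ℝ` is a family of sections of `X` indexed by the
time `t`, smooth when tested along every morphism from a superdomain to `X`. This definition needs
no choice of charts, and `family_contDiffAt` shows that one chart suffices to test it near points in
the image of that chart. Two facts make this work. First, pull-back automatically respects values of
functions (`body_ev`): a function that differs from its pulled-back value would, after subtraction
of that value, be invertible near the point, while its pull-back has body zero. Secondly, the kernel
of the body map on `m` odd generators has vanishing power `m + 1` (`Grassmann.body_pow`). Repeated
use of Hadamard's lemma around the underlying point therefore leaves a remainder in a zero ideal,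
and `smooth_family` obtains a smooth family as a finite expression. Consequently `prodChart` turns
charts of `X` into charts of the product, which is again a supermanifold.

For the universal property, let `φ : T ⟶ X` and `τ : T ⟶ ℝ` be given. Along a morphism from a
superdomain to `T`, the pulled-back time coordinate is a real number plus an even nilpotent element
`ν`. A family `f` must be pulled back to the finite Taylor sum of the terms `(1 / k!) ∂_t^k f ·
ν^k`; this is `pairEv`, built on `jetEval`. It is multiplicative by the Leibniz rule, because even
elements are central and the products of high total degree vanish (`jetEval_mul`). The sum has `n +
2` terms for `n` odd generators: the nilpotency alone would allow `n + 1`, but the linear term must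
be present even for `n = 0`, so that the time coordinate is reproduced (`jetEval_id`).

`expansion` writes a family locally as a polynomial in `t - t₀` whose coefficients are pulled back
from `X`, plus `(t - t₀) ^ N` times another family. A suitable power of the pulled-back `t - t₀`
vanishes at the chosen point, so the remainder disappears there. This yields uniqueness
(`ev_prod_determined`, `lift_unique`). The same expansion shows that the values prescribed by
`pairEv` in one chart of `T` are correct along every other morphism from a superdomain
(`pair_natural`), so the local sections glue and give a morphism with the prescribed components
(`exists_pair`, `exists_lift`). Existence of lifts is what gives sense to `ψ × g_l`; uniqueness is
what makes the product respect identities and composition. -/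

/-- Not a definitional equality: in `ℝ` the product `1 * t` does not reduce to `t`, so the preimage
of an open set under the scaling and the open set itself are equal only by a proof, and the two
pull-backs take values in different types. -/
theorem scaling_one : scaling 1 = 𝟙 realLine := by
  have h : (fun t : ℝ => (1 : ℝ) * t) = id := funext one_mul
  -- `SuperSpace.Hom.ext'` compares pull-backs after a restriction along the equality of the two
  -- preimages, which replaces any transport between types of sections.
  refine SuperSpace.Hom.ext' (ContinuousMap.ext fun t => congrFun h t) fun U s => ?_
  -- A function on the line is a smooth map to the Grassmann algebra without generators, and both
  -- pull-back and restriction are composition with maps of points. What remains is that `s.1` takes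
  -- equal values at two points of `U` with the same underlying real number.
  exact Subtype.ext (funext fun t => congrArg s.1 (Subtype.ext (one_mul t.1)))

/-- The composite on the right applies `g_l` before `g_m`, so at a point the claim is `l * m * t = m
* (l * t)`. Commutativity of `ℝ` enters here, and only here. It is also the reason that
precomposition, which reverses the order of maps and would in general turn a left action into a
right one, still gives an action in the stated order. -/
theorem scaling_mul (l m : ℝ) : scaling (l * m) = scaling l ≫ scaling m := by
  have h : ∀ t : ℝ, l * m * t = m * (l * t) := fun t => by ring
  refine SuperSpace.Hom.ext' (ContinuousMap.ext h) fun U s => ?_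
  -- As for the unit, the two pull-backs evaluate `s.1` at points that agree as real numbers; the
  -- two proofs of membership in `U` play no role.
  exact Subtype.ext (funext fun t => congrArg s.1 (Subtype.ext (h t.1)))

/-! ### The induced action on curves -/

/-- Since `g_1` is the identity, so is `Id × g_1`, because a product of identities is an identity;
precomposition with it changes nothing. -/
theorem SCurve.act_one (M S : Supermanifold) (γ : SCurve M S) : SCurve.act M S (1, γ) = γ := by
  simp only [SCurve.act, scaling_one, prod.map_id_id, Category.id_comp]

/-- Acting by `m` first puts `Id × g_m` next to `γ`; acting by `l` afterwards puts `Id × g_l` in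
front of it. In diagrammatic order the right side is thus `(Id × g_l) ≫ (Id × g_m) ≫ γ`, which is
the order in which `scaling_mul` splits `g_{lm}`. -/
theorem SCurve.act_mul (M S : Supermanifold) (l m : ℝ) (γ : SCurve M S) :
    SCurve.act M S (l * m, γ) = SCurve.act M S (l, SCurve.act M S (m, γ)) := by
  -- Fusing the two product maps on the right leaves `Id ≫ Id` on the factor `S`; `Category.comp_id`
  -- collapses it, and both sides become precomposition with `Id × (g_l ≫ g_m)`.
  simp only [SCurve.act, scaling_mul, prod.map_map_assoc, Category.comp_id]

/-- The interchange law for the product: `ψ` touches only the parameter factor and `g_l` only the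
time factor, so their order is immaterial. This is naturality evaluated at one scalar and one curve.
-/
theorem SCurve.act_induced (M : Supermanifold) {P S : Supermanifold} (ψ : P ⟶ S) (l : ℝ)
    (γ : SCurve M S) :
    SCurve.act M P (l, SCurve.induced M ψ γ) = SCurve.induced M ψ (SCurve.act M S (l, γ)) := by
  -- Both sides are brought to the normal form `(ψ × g_l) ≫ γ`. Both unit laws are needed, because
  -- the identities stand on the left of `ψ` and `g_l` in some places and on the right in others.
  simp only [SCurve.act, SCurve.induced, prod.map_map_assoc, Category.comp_id, Category.id_comp]

end SuperGeometry

theorem mainTheorem5 (M : Supermanifold) :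
    (∀ (S : Supermanifold) (γ : SCurve M S), SCurve.act M S (1, γ) = γ) ∧
    (∀ (S : Supermanifold) (l m : ℝ) (γ : SCurve M S),
      SCurve.act M S (l * m, γ) = SCurve.act M S (l, SCurve.act M S (m, γ))) ∧
    (∀ (P S : Supermanifold) (ψ : P ⟶ S),
      SCurve.act M P ∘ Prod.map id (SCurve.induced M ψ) = SCurve.induced M ψ ∘ SCurve.act M S) :=
  ⟨fun S γ => SCurve.act_one M S γ, fun S l m γ => SCurve.act_mul M S l m γ,
    -- The equality of maps on `ℝ × SCurve M S` is tested at a pair `a`. There `Prod.map id` leaves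
    -- the scalar `a.1` alone and moves only the curve `a.2`, and `a` agrees with `(a.1, a.2)`
    -- definitionally, so the pointwise form of naturality applies as it stands.
    fun _ _ ψ => funext fun a => SCurve.act_induced M ψ a.1 a.2⟩
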